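/- Fix a real number $r$ with $0<r<1$. Let $\lambda$ denote Lebesgue (outer) measure on $[0,1]^m$, and for $X\subseteq[0,1]$ let $$H^r(X)=\inf\Big\{\sum_{i=0}^\infty\lambda(I_i)^r : X\subseteq\bigcup_{i}I_i,\ \text{each } I_i \text{ an interval}\Big\}$$ be its $r$-Hausdorff capacity. For $A\subseteq[0,1]^d$ and $1\le m\le d$ let $\pi_m(A)$ be the projection of $A$ to the first $m$ coordinates, and, when $d\ge 2$, let $A_x=\{y\in[0,1]^{d-1}:(x,y)\in A\}$ for $x\in[0,1]$. For $\delta,\epsilon>0$ the relation $\Xi_{\delta,\epsilon}(X,Y)$ is defined by recursion on the dimension. For $X,Y\subseteq[0,1]$ it holds if and only if $H^r((X\cap Y)\setminus Z)>H^r(Y)-\delta$ for every set $Z\subseteq[0,1]$ with $\lambda(Z)<\epsilon$. For $X,Y\subseteq[0,1]^{d+1}$ with $d\ge1$ it holds if and only if $$\Xi_{\delta,\epsilon}\big(\{x\in\pi_1(Y):\Xi_{\delta,\epsilon}(X_x,Y_x)\},\ \pi_1(Y)\big).$$ A subset of $[0,1]$ is elementary if it is of the form $[p_0,q_0]\cup\dots\cup[p_k,q_k]$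 with $k\ge 0$, rational $p_i<q_i$ for all $i\le k$ and $q_i<p_{i+1}$ for all $i<k$; a subset of $[0,1]^{d+1}$ with $d\ge1$ is elementary if it is of the form $\bigcup_{i=0}^k[p_i,q_i]\times X_i$ with $[p_0,q_0]\cup\dots\cup[p_k,q_k]\subseteq[0,1]$ as before and each $X_i\subseteq[0,1]^d$ elementary. A normal family of dimension $d\ge1$ is a sequence ${\cal C}=\{C_i\}_{i\in\omega}$ of elementary subsets of $[0,1]^d$ such that for all $i$: $C_{i+1}\subseteq C_i$; $\lambda(\pi_m(C_i)\setminus\pi_m(C_{i+1}))<\lambda(\pi_m(C_i))/2^{i+2}$ for $1\le m\le d$; and, if $i\ge1$, there is $\beta(i)>0$ such that $\Xi_{1/i,\beta(i)}(C_j,C_j)$ holds for all $j\ge i$. For $n\in\omega$ let $W_n$ be the family of all sets $a=\bigcup_{i=0}^kI_i\subseteq[0,1]$, $k\ge 0$, where each $I_i$ is an interval (open, closed or half-open) with rational endpoints $p<q$ in $[0,1]$ and $\sum_{i=0}^k\lambda(I_i)<2^{-n}$. For $\delta>0$, a normal family ${\cal C}$ of some dimension $d\ge1$ and a continuous $f:[0,1]^d\to[0,1]$,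 let $X(f,{\cal C},\delta)$ be the set of all $a\in W_n$ such that for every $\epsilon>0$ there are infinitely many $i\in\omega$ for which $\Xi_{\delta,\epsilon}(f^{-1}a,C_i)$ fails. Let ${\cal I}^r_n$ be the collection of all $Y\subseteq W_n$ that are contained in some such $X(f,{\cal C},\delta)$ (with $d$, $f$, ${\cal C}$ and $\delta$ arbitrary). Then for every $n\in\omega$ no finite union of sets of the form $X(f,{\cal C},\delta)$ covers $W_n$, and ${\cal I}^r_n$ is a proper ideal on $W_n$ that contains all finite subsets of $W_n$; that is, ${\cal I}^r_n$ is a collection of subsets of $W_n$ that is closed under subsets and finite unions, contains every finite subset of $W_n$, and $W_n\notin{\cal I}^r_n$. -/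

import Mathlib

open scoped ENNReal

noncomputable section

/-- The `r`-Hausdorff capacity `H^r(X)` of a set `X ⊆ [0,1]`: the infimum of `∑ λ(J i) ^ r` over all
countable covers of `X` by intervals (order-connected subsets of `[0,1]`; the empty set and single
points are allowed and contribute `0` when `r > 0`). -/
def hausdorffCapacity (r : ℝ) (X : Set unitInterval) : ℝ≥0∞ :=
  ⨅ (J : ℕ → Set unitInterval) (_ : ∀ i, (J i).OrdConnected) (_ : X ⊆ ⋃ i, J i),
    ∑' i, (MeasureTheory.volume (J i)) ^ r

/-- The relation `Ξ_{δ,ε}(X, Y)` for subsets of `[0,1]`: for every set `Z` with `λ(Z) < ε`,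
`H^r((X ∩ Y) \ Z) > H^r(Y) - δ`. The inequality is written additively because subtraction in `ℝ≥0∞`
truncates. `Z` is arbitrary, `λ(Z)` being its outer measure. -/
def XiOne (r δ ε : ℝ) (X Y : Set unitInterval) : Prop :=
  ∀ Z : Set unitInterval, MeasureTheory.volume Z < ENNReal.ofReal ε →
    hausdorffCapacity r Y < hausdorffCapacity r ((X ∩ Y) \ Z) + ENNReal.ofReal δ

/-- The vertical section `A_x = {y : (x, y) ∈ A}` over a first coordinate `x`. -/
def cubeSection {d : ℕ} (A : Set (Fin (d + 1) → unitInterval)) (x : unitInterval) :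
    Set (Fin d → unitInterval) :=
  {y | (Fin.cons x y : Fin (d + 1) → unitInterval) ∈ A}

/-- The projection `π_1(A)` to the first coordinate, as a subset of `[0,1]`. -/
def firstProj {d : ℕ} (A : Set (Fin (d + 1) → unitInterval)) : Set unitInterval :=
  (fun z => z 0) '' A

/-- The projection `π_n(A)` of `A ⊆ [0,1]^d` to the first `n ≤ d` coordinates. -/
def cubeProj {d : ℕ} (n : ℕ) (h : n ≤ d) (A : Set (Fin d → unitInterval)) :
    Set (Fin n → unitInterval) :=
  (fun z i => z (Fin.castLE h i)) '' A

/-- The relation `Ξ_{δ,ε}(X, Y)` for subsets of `[0,1]^(d+1)`, by recursion on `d`. -/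
def Xi (r δ ε : ℝ) : (d : ℕ) → (X Y : Set (Fin (d + 1) → unitInterval)) → Prop
  | 0, X, Y => XiOne r δ ε (firstProj X) (firstProj Y)
  | d + 1, X, Y =>
      XiOne r δ ε {x | x ∈ firstProj Y ∧ Xi r δ ε d (cubeSection X x) (cubeSection Y x)}
        (firstProj Y)

/-- The rationals `p i`, `q i` (`i ≤ k`) are the endpoints of finitely many pairwise disjoint
non-degenerate closed subintervals `[p 0, q 0], …, [p k, q k]` of `[0,1]`, listed in increasing
order. -/
structure IsElementaryList {k : ℕ} (p q : Fin (k + 1) → ℚ) : Prop where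
  nonneg : ∀ i, 0 ≤ p i
  le_one : ∀ i, q i ≤ 1
  lt : ∀ i, p i < q i
  lt_next : ∀ i j, i < j → q i < p j

/-- Elementary subsets of `[0,1]^(d+1)`: for `d = 0` a set `[p 0, q 0] ∪ … ∪ [p k, q k]`, and in the
next dimension a set `⋃ i, [p i, q i] × S i` with every `S i` elementary. -/
def IsElementary : (d : ℕ) → Set (Fin (d + 1) → unitInterval) → Prop
  | 0, X => ∃ (k : ℕ) (p q : Fin (k + 1) → ℚ), IsElementaryList p q ∧
      X = {z | ∃ i, (p i : ℝ) ≤ (z 0 : ℝ) ∧ (z 0 : ℝ) ≤ (q i : ℝ)}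
  | d + 1, X => ∃ (k : ℕ) (p q : Fin (k + 1) → ℚ) (S : Fin (k + 1) → Set (Fin (d + 1) → unitInterval)),
      IsElementaryList p q ∧ (∀ i, IsElementary d (S i)) ∧
      X = {z | ∃ i, (p i : ℝ) ≤ (z 0 : ℝ) ∧ (z 0 : ℝ) ≤ (q i : ℝ) ∧ (fun j => z (Fin.succ j)) ∈ S i}

/-- Normal families `C 0 ⊇ C 1 ⊇ …` of dimension `d + 1`. -/
structure IsNormalFamily (r : ℝ) (d : ℕ) (C : ℕ → Set (Fin (d + 1) → unitInterval)) : Prop where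
  elementary : ∀ i, IsElementary d (C i)
  subset : ∀ i, C (i + 1) ⊆ C i
  measure_diff : ∀ (i n : ℕ) (h : n ≤ d + 1), 1 ≤ n →
    MeasureTheory.volume (cubeProj n h (C i) \ cubeProj n h (C (i + 1))) <
      MeasureTheory.volume (cubeProj n h (C i)) / 2 ^ (i + 2)
  witness : ∀ i : ℕ, 1 ≤ i → ∃ β : ℝ, 0 < β ∧ ∀ j, i ≤ j → Xi r (1 / (i : ℝ)) β d (C j) (C j)

/-- A rational interval in `[0,1]`: an interval (open, closed or half-open) whose endpoints are
rationals `p < q` in `[0,1]`. -/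
def IsRationalInterval (J : Set unitInterval) : Prop :=
  ∃ p q : ℚ, 0 ≤ p ∧ p < q ∧ q ≤ 1 ∧
    {t : unitInterval | (p : ℝ) < (t : ℝ) ∧ (t : ℝ) < (q : ℝ)} ⊆ J ∧
    J ⊆ {t : unitInterval | (p : ℝ) ≤ (t : ℝ) ∧ (t : ℝ) ≤ (q : ℝ)}

/-- `W_n`: all finite unions `J 0 ∪ … ∪ J k` of rational intervals with `∑ λ(J i) < 2^(-n)`. -/
def WFamily (n : ℕ) : Set (Set unitInterval) :=
  {a | ∃ (k : ℕ) (J : Fin (k + 1) → Set unitInterval), (∀ i, IsRationalInterval (J i)) ∧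
    ∑ i, MeasureTheory.volume (J i) < (2 ^ n)⁻¹ ∧ a = ⋃ i, J i}

/-- `X(f, C, δ)`: the `a ∈ W_n` such that for every `ε > 0` the relation `Ξ_{δ,ε}(f⁻¹ a, C i)` fails
for infinitely many `i`. -/
def generatorSet (r : ℝ) (n : ℕ) {d : ℕ} (f : C(Fin (d + 1) → unitInterval, unitInterval))
    (C : ℕ → Set (Fin (d + 1) → unitInterval)) (δ : ℝ) : Set (Set unitInterval) :=
  {a | a ∈ WFamily n ∧ ∀ ε : ℝ, 0 < ε → {i : ℕ | ¬ Xi r δ ε d (f ⁻¹' a) (C i)}.Infinite}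

/-- `G` is one of the sets `X(f, C, δ)`, with `δ > 0`, `C` a normal family of some dimension
`d + 1 ≥ 1`, and `f : [0,1]^(d+1) → [0,1]` continuous. -/
def IsGenerator (r : ℝ) (n : ℕ) (G : Set (Set unitInterval)) : Prop :=
  ∃ (d : ℕ) (f : C(Fin (d + 1) → unitInterval, unitInterval))
    (C : ℕ → Set (Fin (d + 1) → unitInterval)) (δ : ℝ),
    0 < δ ∧ IsNormalFamily r d C ∧ G = generatorSet r n f C δ

/-- `I^r_n`: the subsets of `W_n` contained in some generator. -/
def capacityIdeal (r : ℝ) (n : ℕ) : Set (Set (Set unitInterval)) :=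
  {Y | Y ⊆ WFamily n ∧ ∃ G, IsGenerator r n G ∧ Y ⊆ G}

/-- `I` is a proper ideal of subsets of `W` that contains all finite subsets of `W`. -/
structure IsProperIdealOn {α : Type*} (W : Set α) (I : Set (Set α)) : Prop where
  subset : ∀ Y ∈ I, Y ⊆ W
  finite_mem : ∀ Y, Y ⊆ W → Y.Finite → Y ∈ I
  mono : ∀ Y ∈ I, ∀ Z, Z ⊆ Y → Z ∈ I
  union_mem : ∀ Y ∈ I, ∀ Z ∈ I, Y ∪ Z ∈ I
  proper : W ∉ I

end

/-! ### Hausdorff capacity and its stability under passing to subsets of positive density. -/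

section Capacity

open MeasureTheory Set

variable {r : ℝ}

/-! Two facts carry the theorem: any two generators lie in a third, and no single generator covers
`W_n`.

For the first, place two normal families of equal dimension over `[0,p]` and `[1-p,1]`, where `p <
1/2` and `2p^r ≥ 1`. The union of these intervals has capacity one by the mass distribution
principle, while each of them has capacity at most `p^r < 1`. With slack at most `1 - p^r`, the set
of good first coordinates must meet both intervals, so failure in either family makes the combined
family fail (`IsSmall.union_of_eq_dim`). Doubling a generator in this way also raises its dimension,
which makes dimensions equal.

For the second, some `a ∈ W_n` must have a preimage that is large in all late `C j`. It consists of
random cells of a fine grid, each chosen with a small probability `m`, and boundedly many forced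
cells; the latter are unavoidable because `f` may be constant on large sets. A random choice catches
only a fraction of the points, but this hardly lowers capacity. Since `r < 1`, the short intervals
of a cheap cover have small total measure, and the long ones can be taken from a finite net. So
positive density on finitely many test sets is enough (`Robust.exists_finite_test`).

The dimension is handled by induction (`XiStrong.exists_forced`). Over each first coordinate `x` the
section asks for a bounded set of forced cells. Cells asked for by many `x` are forced outright. The
remaining requests rarely overlap, so by a second moment estimate a proportion of about `m^k` of the
`x` is satisfied at random (`exists_forced_set`). All this is applied to `K = ⋂ C j`, which inherits
largeness from one `C J` (`XiStrong.of_xi`), so that one `a` serves every `j ≥ J`. -/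

theorem hausdorffCapacity_mono {X Y : Set unitInterval} (h : X ⊆ Y) :
    hausdorffCapacity r X ≤ hausdorffCapacity r Y := by
  refine le_iInf fun J => le_iInf fun hJ => le_iInf fun hc => ?_
  exact iInf_le_of_le J (iInf_le_of_le hJ (iInf_le_of_le (h.trans hc) le_rfl))

theorem hausdorffCapacity_le_tsum {X : Set unitInterval} {J : ℕ → Set unitInterval}
    (hJ : ∀ i, (J i).OrdConnected) (hX : X ⊆ ⋃ i, J i) :
    hausdorffCapacity r X ≤ ∑' i, volume (J i) ^ r :=
  iInf_le_of_le J (iInf_le_of_le hJ (iInf_le_of_le hX le_rfl))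

theorem hausdorffCapacity_le_of_ordConnected (hr : 0 < r) {J : Set unitInterval}
    (hJ : J.OrdConnected) : hausdorffCapacity r J ≤ volume J ^ r := by
  refine (hausdorffCapacity_le_tsum (J := fun i => if i = 0 then J else ∅) ?_ ?_).trans ?_
  · intro i
    by_cases hi : i = 0
    · simpa [hi] using hJ
    · simpa [hi] using ordConnected_empty
  · intro x hx
    exact mem_iUnion.2 ⟨0, by simpa using hx⟩
  · rw [tsum_eq_single 0]
    · simp
    · intro i hi
      simp [hi, hr]

theorem hausdorffCapacity_le_one (hr : 0 < r) (X : Set unitInterval) :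
    hausdorffCapacity r X ≤ 1 := by
  refine (hausdorffCapacity_mono (subset_univ X)).trans
    ((hausdorffCapacity_le_of_ordConnected hr ordConnected_univ).trans ?_)
  simp

theorem hausdorffCapacity_empty (hr : 0 < r) : hausdorffCapacity r ∅ = 0 := by
  simpa [hr] using hausdorffCapacity_le_of_ordConnected hr (J := ∅) ordConnected_empty

theorem exists_cover_of_hausdorffCapacity_lt {X : Set unitInterval} {c : ℝ≥0∞}
    (h : hausdorffCapacity r X < c) :
    ∃ J : ℕ → Set unitInterval, (∀ i, (J i).OrdConnected) ∧ X ⊆ ⋃ i, J i ∧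
      ∑' i, volume (J i) ^ r < c := by
  simpa only [hausdorffCapacity, iInf_lt_iff, exists_prop] using h

/-- There are finitely many closed intervals such that each interval is contained in one of them
whose length is at most `τ` larger. -/
theorem exists_finite_interval_net {τ : ℝ} (hτ : 0 < τ) :
    ∃ 𝒰 : Set (Set unitInterval), 𝒰.Finite ∧
      (∀ U ∈ 𝒰, MeasurableSet U ∧ U.OrdConnected) ∧
      ∀ J : Set unitInterval, J.OrdConnected →
        ∃ U ∈ 𝒰, J ⊆ U ∧ volume U ≤ volume J + ENNReal.ofReal τ := by
  -- The net consists of intervals between grid points `i / L`; rounding both ends outwards adds at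
  -- most `τ / 2` each.
  obtain ⟨L, hL⟩ := exists_nat_gt (2 / τ)
  have hL0 : (0 : ℝ) < L := lt_trans (by positivity) hL
  have hLτ : 1 / (L : ℝ) ≤ τ / 2 := by
    rw [div_lt_iff₀ hτ] at hL
    rw [div_le_iff₀ hL0]
    linarith
  let pt : ℕ → unitInterval := fun i => projIcc 0 1 zero_le_one ((i : ℝ) / L)
  have hpt : ∀ i ≤ L, (pt i : ℝ) = (i : ℝ) / L := by
    intro i hi
    have : (i : ℝ) / L ∈ Icc (0 : ℝ) 1 :=
      ⟨by positivity, (div_le_one hL0).2 (by exact_mod_cast hi)⟩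
    simp only [pt, projIcc_of_mem zero_le_one this]
  have hlow : ∀ x : unitInterval, ∃ i ≤ L, pt i ≤ x ∧ (x : ℝ) ≤ pt i + τ / 2 := by
    intro x
    have hx0 : (0 : ℝ) ≤ x * L := mul_nonneg x.2.1 hL0.le
    have h1 := Nat.floor_le hx0
    have h2 := Nat.lt_floor_add_one ((x : ℝ) * L)
    have hi : ⌊(x : ℝ) * L⌋₊ ≤ L := by
      have : (x : ℝ) * L ≤ L := mul_le_of_le_one_left hL0.le x.2.2
      exact_mod_cast h1.trans this
    refine ⟨_, hi, ?_, ?_⟩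
    · rw [← Subtype.coe_le_coe, hpt _ hi, div_le_iff₀ hL0]
      exact h1
    · rw [hpt _ hi]
      refine le_trans ?_ (add_le_add_right hLτ _)
      rw [← add_div, le_div_iff₀ hL0]
      exact h2.le
  have hupp : ∀ x : unitInterval, ∃ i ≤ L, x ≤ pt i ∧ (pt i : ℝ) ≤ x + τ / 2 := by
    intro x
    have hx0 : (0 : ℝ) ≤ x * L := mul_nonneg x.2.1 hL0.le
    have h1 := Nat.le_ceil ((x : ℝ) * L)
    have h2 := Nat.ceil_lt_add_one hx0
    have hi : ⌈(x : ℝ) * L⌉₊ ≤ L := Nat.ceil_le.2 (mul_le_of_le_one_left hL0.le x.2.2)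
    refine ⟨_, hi, ?_, ?_⟩
    · rw [← Subtype.coe_le_coe, hpt _ hi, le_div_iff₀ hL0]
      exact h1
    · rw [hpt _ hi]
      refine le_trans ?_ (add_le_add_right hLτ _)
      rw [div_le_iff₀ hL0, add_mul, one_div, inv_mul_cancel₀ hL0.ne']
      exact h2.le
  refine ⟨(fun ij : ℕ × ℕ => Icc (pt ij.1) (pt ij.2)) '' (Iic L ×ˢ Iic L),
    ((finite_Iic L).prod (finite_Iic L)).image _, ?_, ?_⟩
  · rintro _ ⟨ij, -, rfl⟩
    exact ⟨measurableSet_Icc, ordConnected_Icc⟩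
  · intro J hJ
    rcases J.eq_empty_or_nonempty with rfl | hne
    · exact ⟨_, ⟨(0, 0), by simp, rfl⟩, empty_subset _, by simp⟩
    obtain ⟨i, hi, hia, hia'⟩ := hlow (sInf J)
    obtain ⟨j, hj, hjb, hjb'⟩ := hupp (sSup J)
    refine ⟨_, ⟨(i, j), ⟨hi, hj⟩, rfl⟩, ?_, ?_⟩
    · exact fun x hx => ⟨hia.trans (csInf_le (OrderBot.bddBelow J) hx),
        (le_csSup (OrderTop.bddAbove J) hx).trans hjb⟩
    · have hsub : Ioo (sInf J) (sSup J) ⊆ J := by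
        intro x hx
        obtain ⟨y, hy, hyx⟩ := exists_lt_of_csInf_lt hne hx.1
        obtain ⟨z, hz, hxz⟩ := exists_lt_of_lt_csSup hne hx.2
        exact hJ.out hy hz ⟨hyx.le, hxz.le⟩
      calc volume (Icc (pt i) (pt j))
          = ENNReal.ofReal (pt j - pt i) := unitInterval.volume_Icc _ _
        _ ≤ ENNReal.ofReal (((sSup J : unitInterval) - (sInf J : unitInterval) : ℝ) + τ) :=
            ENNReal.ofReal_le_ofReal (by linarith)
        _ ≤ _ := ENNReal.ofReal_add_le
        _ = volume (Ioo (sInf J) (sSup J)) + ENNReal.ofReal τ := by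
            rw [unitInterval.volume_Ioo]
        _ ≤ _ := by gcongr

/-- `E` keeps capacity more than `h - δ` after removing any set of measure less than `ε`. -/
def Robust (r δ ε : ℝ) (E : Set unitInterval) (h : ℝ≥0∞) : Prop :=
  ∀ Z : Set unitInterval, volume Z < ENNReal.ofReal ε →
    h < hausdorffCapacity r (E \ Z) + ENNReal.ofReal δ

theorem Robust.mono {δ δ' ε ε' : ℝ} {E E' : Set unitInterval} {h h' : ℝ≥0∞}
    (H : Robust r δ ε E h) (hδ : δ ≤ δ') (hε : ε' ≤ ε) (hE : E ⊆ E') (hh : h' ≤ h) :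
    Robust r δ' ε' E' h' := by
  intro Z hZ
  refine hh.trans_lt ((H Z (hZ.trans_le (ENNReal.ofReal_le_ofReal hε))).trans_le ?_)
  exact add_le_add (hausdorffCapacity_mono (sdiff_subset_sdiff_left hE))
    (ENNReal.ofReal_le_ofReal hδ)

/-- The part of a set covered by short intervals of a family of small total cost has small
measure. -/
theorem measure_biUnion_short_le (hr1 : r < 1) {J : ℕ → Set unitInterval} {s : ℝ≥0∞}
    (hcost : ∑' i, volume (J i) ^ r ≤ 1) :
    volume (⋃ i ∈ {i | volume (J i) ≤ s}, J i) ≤ s ^ (1 - r) := by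
  calc volume (⋃ i ∈ {i | volume (J i) ≤ s}, J i)
      ≤ ∑' i : {i | volume (J i) ≤ s}, volume (J i) := by
        rw [biUnion_eq_iUnion]
        exact measure_iUnion_le _
    _ ≤ ∑' i : {i | volume (J i) ≤ s}, s ^ (1 - r) * volume (J i) ^ r := by
        refine ENNReal.tsum_le_tsum fun i => ?_
        by_cases h0 : volume (J i) = 0
        · simp [h0]
        · calc volume (J i) = volume (J i) ^ (1 - r) * volume (J i) ^ r := by
                rw [← ENNReal.rpow_add _ _ h0 (measure_ne_top _ _)]
                simp
            _ ≤ _ := mul_le_mul' (ENNReal.rpow_le_rpow i.2 (by linarith)) le_rfl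
    _ = s ^ (1 - r) * ∑' i : {i | volume (J i) ≤ s}, volume (J i) ^ r := ENNReal.tsum_mul_left
    _ ≤ s ^ (1 - r) * 1 := by
        gcongr
        exact (ENNReal.tsum_comp_le_tsum_of_injective Subtype.val_injective
          (fun i => volume (J i) ^ r)).trans hcost
    _ = _ := mul_one _

theorem exists_pos_ofReal_rpow_le {q c : ℝ} (hq : 0 < q) (hc : 0 < c) :
    ∃ s : ℝ, 0 < s ∧ ENNReal.ofReal s ^ q ≤ ENNReal.ofReal c := by
  refine ⟨c ^ q⁻¹, by positivity, ?_⟩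
  rw [ENNReal.ofReal_rpow_of_pos (by positivity), Real.rpow_inv_rpow hc.le hq.ne']

/-- Capacity transfer: a set `G` that has density at least `μ` in a robust set `E`, as tested by
finitely many measurable sets, is itself robust. -/
theorem Robust.exists_finite_test (hr0 : 0 < r) (hr1 : r < 1) {δ ε μ : ℝ} (hδ : 0 < δ)
    (hε : 0 < ε) (hμ : 0 < μ) :
    ∃ 𝒱 : Set (Set unitInterval), 𝒱.Finite ∧ (∀ V ∈ 𝒱, MeasurableSet V) ∧ ∃ ε' : ℝ, 0 < ε' ∧
      ∀ δ₀ : ℝ, 0 ≤ δ₀ → ∀ (E G : Set unitInterval) (h : ℝ≥0∞), Robust r δ₀ ε E h →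
        (∀ V ∈ 𝒱, ENNReal.ofReal μ * volume (E ∩ V) ≤
          volume (G ∩ V) + ENNReal.ofReal (μ * (ε / 2))) →
        Robust r (δ₀ + δ) ε' G h := by
  -- Intervals of length at most `s` in a cover of cost at most one have total measure at most `μ *
  -- (ε / 8)`. Lengthening a longer one by `c * s` raises its cost by a factor of at most `1 + δ /
  -- 2`.
  obtain ⟨s, hs0, hs⟩ := exists_pos_ofReal_rpow_le (sub_pos.2 hr1)
    (show 0 < μ * (ε / 8) by positivity)
  obtain ⟨c, hc0, hc⟩ := exists_pos_ofReal_rpow_le hr0 (half_pos hδ)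
  obtain ⟨𝒰, hfin, hU, hnet⟩ := exists_finite_interval_net (mul_pos hc0 hs0)
  -- The tests are the complements of all possible unions of net intervals.
  refine ⟨(fun 𝒮 : Set (Set unitInterval) => (⋃₀ 𝒮)ᶜ) '' 𝒰.powerset, hfin.powerset.image _,
    ?_, μ * (ε / 8), by positivity, ?_⟩
  · rintro _ ⟨𝒮, h𝒮, rfl⟩
    exact (MeasurableSet.sUnion (hfin.subset h𝒮).countable fun t ht => (hU t (h𝒮 ht)).1).compl
  intro δ₀ hδ₀ E G h hE hdens Z hZ
  by_contra! hcon
  have hlt : h < 1 + ENNReal.ofReal δ₀ := by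
    refine (hE ∅ (by simpa using hε)).trans_le ?_
    gcongr
    exact hausdorffCapacity_le_one hr0 _
  -- Capacity never exceeds one, so failure of robustness leaves room for a cover of `G \ Z` of cost
  -- below one.
  have hGZ : hausdorffCapacity r (G \ Z) < 1 := by
    by_contra! h1
    refine absurd hlt (not_lt.2 (le_trans ?_ hcon))
    gcongr
    linarith
  have hGZ' : hausdorffCapacity r (G \ Z) <
      min 1 (hausdorffCapacity r (G \ Z) + ENNReal.ofReal (δ / 2)) :=
    lt_min hGZ (ENNReal.lt_add_right hGZ.ne_top (by simpa using hδ))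
  obtain ⟨J, hJ, hcov, hcost⟩ := exists_cover_of_hausdorffCapacity_lt hGZ'
  rw [lt_min_iff] at hcost
  choose U hU𝒰 hJU hUvol using fun i => hnet (J i) (hJ i)
  set S : ℝ≥0∞ := ENNReal.ofReal s with hS
  have hS0 : S ≠ 0 := by simpa [hS] using hs0
  set W : Set unitInterval := ⋃₀ (U '' {i | S < volume (J i)}) with hW
  have hV := hdens Wᶜ ⟨_, image_subset_iff.2 fun i _ => hU𝒰 i, rfl⟩
  have hGW : G ∩ Wᶜ ⊆ Z ∪ ⋃ i ∈ {i | volume (J i) ≤ S}, J i := by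
    rintro x ⟨hxG, hxW⟩
    by_cases hxZ : x ∈ Z
    · exact Or.inl hxZ
    obtain ⟨i, hi⟩ := mem_iUnion.1 (hcov ⟨hxG, hxZ⟩)
    refine Or.inr (mem_iUnion₂.2 ⟨i, ?_, hi⟩)
    by_contra hiS
    exact hxW ⟨U i, mem_image_of_mem _ (show S < volume (J i) from not_le.1 hiS), hJU i hi⟩
  -- Outside the long intervals, `G` has only the measure of `Z` and of the short intervals. By the
  -- density test, `E \ W` is then small enough to be removed from `E`.
  have hsmall : volume (E \ W) < ENNReal.ofReal ε := by
    have h1 : ENNReal.ofReal μ * volume (E ∩ Wᶜ) < ENNReal.ofReal μ * ENNReal.ofReal ε := by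
      calc ENNReal.ofReal μ * volume (E ∩ Wᶜ)
          ≤ volume (G ∩ Wᶜ) + ENNReal.ofReal (μ * (ε / 2)) := hV
        _ ≤ (volume Z + S ^ (1 - r)) + ENNReal.ofReal (μ * (ε / 2)) := by
            gcongr
            refine (measure_mono hGW).trans ((measure_union_le _ _).trans ?_)
            gcongr
            exact measure_biUnion_short_le hr1 hcost.1.le
        _ ≤ (ENNReal.ofReal (μ * (ε / 8)) + ENNReal.ofReal (μ * (ε / 8))) +
              ENNReal.ofReal (μ * (ε / 2)) := by gcongr
        _ = ENNReal.ofReal (μ * (ε / 8) + μ * (ε / 8) + μ * (ε / 2)) := by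
            rw [ENNReal.ofReal_add (by positivity) (by positivity),
              ENNReal.ofReal_add (by positivity) (by positivity)]
        _ < ENNReal.ofReal (μ * ε) := by
            rw [ENNReal.ofReal_lt_ofReal_iff (by positivity)]
            nlinarith [mul_pos hμ hε]
        _ = _ := ENNReal.ofReal_mul hμ.le
    rw [sdiff_eq]
    exact lt_of_mul_lt_mul_left' h1
  -- What remains of `E` is covered by the enlarged long intervals. Each enlargement costs a
  -- fraction of the interval's own cost, so the total increase is bounded however many intervals
  -- there are.
  have hcapW : hausdorffCapacity r (E \ (E \ W)) ≤
      hausdorffCapacity r (G \ Z) + ENNReal.ofReal δ := by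
    classical
    calc hausdorffCapacity r (E \ (E \ W))
        ≤ ∑' i, volume (if S < volume (J i) then U i else ∅) ^ r := by
          refine hausdorffCapacity_le_tsum (fun i => ?_) ?_
          · by_cases hi : S < volume (J i)
            · simpa [hi] using (hU _ (hU𝒰 i)).2
            · simpa [hi] using ordConnected_empty
          · rintro x ⟨hxE, hx⟩
            have hxW : x ∈ W := by
              by_contra hxW
              exact hx ⟨hxE, hxW⟩
            obtain ⟨_, ⟨i, hi, rfl⟩, hxi⟩ := hxW
            exact mem_iUnion.2 ⟨i, by simpa [show S < volume (J i) from hi] using hxi⟩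
      _ ≤ ∑' i, (volume (J i) ^ r + ENNReal.ofReal (δ / 2) * volume (J i) ^ r) := by
          refine ENNReal.tsum_le_tsum fun i => ?_
          by_cases hi : S < volume (J i)
          · rw [if_pos hi]
            calc volume (U i) ^ r ≤ (volume (J i) + ENNReal.ofReal (c * s)) ^ r := by
                  gcongr
                  exact hUvol i
              _ ≤ volume (J i) ^ r + ENNReal.ofReal (c * s) ^ r :=
                  ENNReal.rpow_add_le_add_rpow _ _ hr0.le hr1.le
              _ = volume (J i) ^ r + ENNReal.ofReal c ^ r * S ^ r := by
                  rw [ENNReal.ofReal_mul hc0.le, ENNReal.mul_rpow_of_nonneg _ _ hr0.le]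
              _ ≤ _ := by gcongr
          · simp [hi, hr0]
      _ = ∑' i, volume (J i) ^ r + ENNReal.ofReal (δ / 2) * ∑' i, volume (J i) ^ r := by
          rw [ENNReal.tsum_add, ENNReal.tsum_mul_left]
      _ ≤ (hausdorffCapacity r (G \ Z) + ENNReal.ofReal (δ / 2)) +
            ENNReal.ofReal (δ / 2) * 1 := by
          gcongr
          exacts [hcost.2.le, hcost.1.le]
      _ = _ := by
          rw [mul_one, add_assoc, ← ENNReal.ofReal_add (by positivity) (by positivity),
            add_halves]
  refine absurd (hE _ hsmall) (not_lt.2 (le_trans ?_ hcon))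
  rw [ENNReal.ofReal_add hδ₀ hδ.le, add_comm (ENNReal.ofReal δ₀), ← add_assoc]
  gcongr

end Capacity

/-! ### Random subsets of a finite set and the second moment argument. -/

section RandomSubset

open Finset

variable {α : Type*} [Fintype α] [DecidableEq α] {m : ℝ}

/-- The expectation of `g S`, where the random set `S` contains each point independently with
probability `m`. -/
def subsetExp (m : ℝ) (g : Finset α → ℝ) : ℝ :=
  ∑ S, m ^ #S * (1 - m) ^ #Sᶜ * g S

/-- The probability that the random set lies in `A`. -/
noncomputable def subsetProb (m : ℝ) (A : Set (Finset α)) : ℝ :=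
  subsetExp m (A.indicator 1)

theorem subsetExp_const (c : ℝ) : subsetExp (α := α) m (fun _ => c) = c := by
  have h := Finset.sum_pow_mul_eq_add_pow m (1 - m) (univ : Finset α)
  rw [powerset_univ, add_sub_cancel, one_pow] at h
  rw [subsetExp, ← sum_mul]
  simp_rw [card_compl, ← card_univ]
  rw [h, one_mul]

theorem subsetExp_mono (hm0 : 0 ≤ m) (hm1 : m ≤ 1) {g g' : Finset α → ℝ} (h : ∀ S, g S ≤ g' S) :
    subsetExp m g ≤ subsetExp m g' := by
  refine sum_le_sum fun S _ => mul_le_mul_of_nonneg_left (h S) ?_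
  have : 0 ≤ 1 - m := sub_nonneg.2 hm1
  positivity

theorem subsetExp_add (g g' : Finset α → ℝ) :
    subsetExp m (fun S => g S + g' S) = subsetExp m g + subsetExp m g' := by
  simp only [subsetExp, mul_add, sum_add_distrib]

theorem subsetExp_sub (g g' : Finset α → ℝ) :
    subsetExp m (fun S => g S - g' S) = subsetExp m g - subsetExp m g' := by
  simp only [subsetExp, mul_sub, sum_sub_distrib]

theorem subsetExp_const_mul (c : ℝ) (g : Finset α → ℝ) :
    subsetExp m (fun S => c * g S) = c * subsetExp m g := by
  simp only [subsetExp, mul_sum]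
  exact sum_congr rfl fun S _ => by ring

theorem subsetExp_sum {ι : Type*} (s : Finset ι) (g : ι → Finset α → ℝ) :
    subsetExp m (fun S => ∑ i ∈ s, g i S) = ∑ i ∈ s, subsetExp m (g i) := by
  simp only [subsetExp, mul_sum]
  exact sum_comm

/-- Pairing each `S` containing `j` with `S.erase j` changes its weight by the factor `m / (1 - m)`
and leaves `g` unchanged. -/
theorem subsetExp_mem_mul {j : α} {g : Finset α → ℝ} (hg : ∀ S, g (insert j S) = g S) :
    subsetExp m (fun S => (if j ∈ S then 1 else 0) * g S) = m * subsetExp m g := by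
  have hswap : (1 - m) * ∑ S with j ∈ S, m ^ #S * (1 - m) ^ #Sᶜ * g S =
      m * ∑ S with j ∉ S, m ^ #S * (1 - m) ^ #Sᶜ * g S := by
    rw [mul_sum, mul_sum]
    refine sum_nbij' (fun S => S.erase j) (fun S => insert j S) ?_ ?_ ?_ ?_ ?_
    · intro S _
      simp
    · intro S _
      simp
    · intro S hS
      exact insert_erase (mem_filter.1 hS).2
    · intro S hS
      exact erase_insert (mem_filter.1 hS).2
    · intro S hS
      have hj := (mem_filter.1 hS).2
      have h1 : #S = #(S.erase j) + 1 := (card_erase_add_one hj).symm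
      have h2 : #(S.erase j)ᶜ = #Sᶜ + 1 := by
        rw [compl_erase, card_insert_of_notMem (by simpa using hj)]
      have h3 : g (S.erase j) = g S := by rw [← hg, insert_erase hj]
      rw [h1, h2, h3]
      ring
  have hsplit : subsetExp m g = (∑ S with j ∈ S, m ^ #S * (1 - m) ^ #Sᶜ * g S) +
      ∑ S with j ∉ S, m ^ #S * (1 - m) ^ #Sᶜ * g S :=
    (sum_filter_add_sum_filter_not _ _ _).symm
  have hmem : subsetExp m (fun S => (if j ∈ S then 1 else 0) * g S) =
      ∑ S with j ∈ S, m ^ #S * (1 - m) ^ #Sᶜ * g S := by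
    rw [subsetExp, sum_filter]
    exact sum_congr rfl fun S _ => by split_ifs <;> ring
  rw [hmem, hsplit]
  linarith

/-- The event that the random set contains `A` is independent of what happens outside `A`. -/
theorem subsetExp_subset_mul (A : Finset α) {g : Finset α → ℝ}
    (hg : ∀ j ∈ A, ∀ S, g (insert j S) = g S) :
    subsetExp m (fun S => (if A ⊆ S then 1 else 0) * g S) = m ^ #A * subsetExp m g := by
  induction A using Finset.induction_on with
  | empty => simp
  | insert j A hj ih =>
    have h1 : (fun S => (if insert j A ⊆ S then (1 : ℝ) else 0) * g S) =
        fun S => (if j ∈ S then 1 else 0) * ((if A ⊆ S then 1 else 0) * g S) := by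
      funext S
      by_cases h : j ∈ S <;> simp [insert_subset_iff, h]
    rw [h1, subsetExp_mem_mul, ih fun i hi => hg i (mem_insert_of_mem hi),
      card_insert_of_notMem hj, pow_succ]
    · ring
    · intro S
      simp only [hg j (mem_insert_self _ _), subset_insert_iff_of_notMem hj]

theorem subsetExp_card : subsetExp m (fun S : Finset α => (#S : ℝ)) = m * Fintype.card α := by
  have h : (fun S : Finset α => (#S : ℝ)) =
      fun S => ∑ j, ((if j ∈ S then 1 else 0) * (1 : ℝ)) := by
    funext S
    simp
  rw [h, subsetExp_sum]
  simp_rw [subsetExp_mem_mul (g := fun _ => (1 : ℝ)) (fun _ => rfl), subsetExp_const]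
  simp [mul_comm]

theorem subsetProb_mono (hm0 : 0 ≤ m) (hm1 : m ≤ 1) {A B : Set (Finset α)} (h : A ⊆ B) :
    subsetProb m A ≤ subsetProb m B :=
  subsetExp_mono hm0 hm1 fun S => Set.indicator_le_indicator_of_subset h (fun _ => zero_le_one) S

/-- A subset-valued function `F` of small range can be met by a fixed small set `F'` and a random
set in such a way that good behaviour conditional on `F t ⊆ S` has positive frequency. -/
theorem exists_forced_set {θ κ : ℝ} (hm0 : 0 < m) (hm1 : m ≤ 1) (hθ : 0 < θ) (hκ : 0 < κ)
    (k n : ℕ) :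
    ∃ k' : ℕ, ∀ (α : Type) [Fintype α] [DecidableEq α] (ι : Type) [Fintype ι] (ν : Type)
      [Fintype ν], Fintype.card ν ≤ n → ∀ (p : ι → ℝ) (q : ν → ι → ℝ), (∀ v t, 0 ≤ q v t) →
      (∀ v t, q v t ≤ p t) → (∀ t, 0 ≤ p t) → ∑ t, p t ≤ 1 →
      ∀ F : ι → Finset α, (∀ t, #(F t) ≤ k) →
      ∀ good : ι → Set (Finset α), (∀ t S S', S ⊆ S' → S ∈ good t → S' ∈ good t) →
      (∀ t, p t ≠ 0 → subsetProb m {S | S ∪ F t ∉ good t} ≤ κ * θ / 4) →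
      ∃ F' : Finset α, #F' ≤ k' ∧
        subsetProb m {S | ∃ v, ∑ t, (good t).indicator (fun _ => q v t) (S ∪ F') <
          m ^ k * (∑ t, q v t - θ)} ≤ κ := by
  classical
  -- The threshold of frequency, chosen so that Chebyshev's inequality for all `v` together costs at
  -- most `κ / 2`. It does not depend on `α`, `ι` or `F`, and neither does the bound on `F'`.
  set η : ℝ := m ^ k * κ * θ ^ 2 / (8 * (k + 1) * (n + 1)) with hη
  have hη0 : 0 < η := by positivity
  refine ⟨⌈k / η⌉₊, ?_⟩
  intro α _ _ ι _ ν _ hν p q hq0 hqp hp0 hp1 F hF good hgood hprob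
  -- The points requested with frequency at least `η`. The total frequency is at most `k`, so there
  -- are at most `k / η` of them.
  set F' : Finset α := {j | η ≤ ∑ t, p t * (if j ∈ F t then 1 else 0)} with hF'
  refine ⟨F', ?_, ?_⟩
  · have h1 : (#F' : ℝ) * η ≤ k := by
      calc (#F' : ℝ) * η = ∑ j ∈ F', η := by simp
        _ ≤ ∑ j ∈ F', ∑ t, p t * (if j ∈ F t then 1 else 0) :=
            sum_le_sum fun j hj => (mem_filter.1 hj).2
        _ ≤ ∑ j, ∑ t, p t * (if j ∈ F t then 1 else 0) := by
            refine sum_le_sum_of_subset_of_nonneg (subset_univ _) fun j _ _ => ?_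
            exact sum_nonneg fun t _ => mul_nonneg (hp0 t) (by split_ifs <;> simp)
        _ = ∑ t, p t * #(F t) := by
            rw [sum_comm]
            exact sum_congr rfl fun t _ => by simp [mul_comm]
        _ ≤ ∑ t, p t * k := sum_le_sum fun t _ =>
            mul_le_mul_of_nonneg_left (by exact_mod_cast hF t) (hp0 t)
        _ = (∑ t, p t) * k := (sum_mul _ _ _).symm
        _ ≤ k := mul_le_of_le_one_left (by positivity) hp1
    have h2 : (#F' : ℝ) ≤ k / η := (le_div_iff₀ hη0).2 h1
    exact_mod_cast h2.trans (Nat.le_ceil _)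
  set D : ι → Finset α := fun t => F t \ F' with hD
  have hDk : ∀ t, #(D t) ≤ k := fun t => (card_le_card sdiff_subset).trans (hF t)
  have hmk : ∀ t, (m ^ #(D t))⁻¹ ≤ (m ^ k)⁻¹ := fun t =>
    inv_anti₀ (by positivity) (pow_le_pow_of_le_one hm0.le hm1 (hDk t))
  -- The event that the remaining requests of `t` are met, normalised to have expectation one.
  set y : ι → Finset α → ℝ := fun t S => (m ^ #(D t))⁻¹ * if D t ⊆ S then 1 else 0 with hy
  have hy0 : ∀ t S, 0 ≤ y t S := fun t S => mul_nonneg (by positivity) (by split_ifs <;> simp)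
  have hyk : ∀ t S, m ^ k * y t S ≤ 1 := by
    intro t S
    have : y t S ≤ (m ^ k)⁻¹ := by
      refine le_trans ?_ (hmk t)
      refine mul_le_of_le_one_right (by positivity) (by split_ifs <;> simp)
    calc m ^ k * y t S ≤ m ^ k * (m ^ k)⁻¹ := by gcongr
      _ = 1 := mul_inv_cancel₀ (by positivity)
  have hEy : ∀ t, subsetExp m (y t) = 1 := by
    intro t
    have h := subsetExp_subset_mul (m := m) (D t) (g := fun _ => (1 : ℝ)) (fun _ _ _ => rfl)
    simp only [mul_one, subsetExp_const] at h
    rw [hy, subsetExp_const_mul, h, inv_mul_cancel₀ (by positivity)]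
  -- For disjoint requests the expectation is exactly one; otherwise it is at most `(m ^ k)⁻¹`, and
  -- the sum on the right is at least one.
  have hEyy : ∀ t t', subsetExp m (fun S => y t S * y t' S) ≤
      1 + (m ^ k)⁻¹ * ∑ j ∈ D t, if j ∈ F t' then 1 else 0 := by
    intro t t'
    have h1 : (fun S => y t S * y t' S) = fun S => ((m ^ #(D t))⁻¹ * (m ^ #(D t'))⁻¹) *
        ((if D t ∪ D t' ⊆ S then 1 else 0) * (1 : ℝ)) := by
      funext S
      by_cases h : D t ⊆ S <;> by_cases h' : D t' ⊆ S <;> simp [hy, h, h', union_subset_iff]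
    have hsum0 : 0 ≤ ∑ j ∈ D t, (if j ∈ F t' then (1 : ℝ) else 0) :=
      sum_nonneg fun j _ => by split_ifs <;> simp
    have hcard := card_union_add_card_inter (D t) (D t')
    have h2 : (m ^ #(D t))⁻¹ * (m ^ #(D t'))⁻¹ * m ^ #(D t ∪ D t') =
        (m ^ #(D t ∩ D t'))⁻¹ := by
      rw [← mul_inv, ← pow_add, ← hcard, pow_add]
      field_simp
    rw [h1, subsetExp_const_mul, subsetExp_subset_mul _ (fun _ _ _ => rfl), subsetExp_const,
      mul_one, h2]
    rcases (D t ∩ D t').eq_empty_or_nonempty with h | ⟨j, hj⟩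
    · rw [h, card_empty, pow_zero, inv_one]
      exact le_add_of_nonneg_right (mul_nonneg (by positivity) hsum0)
    · have hjt := (mem_inter.1 hj).1
      have hjt' : j ∈ F t' := (mem_sdiff.1 (mem_inter.1 hj).2).1
      have h3 : (1 : ℝ) ≤ ∑ j ∈ D t, (if j ∈ F t' then (1 : ℝ) else 0) := by
        refine le_trans (by simp [hjt']) (single_le_sum (f := fun j => if j ∈ F t' then (1 : ℝ)
          else 0) (fun i _ => by split_ifs <;> simp) hjt)
      have h4 : (m ^ #(D t ∩ D t'))⁻¹ ≤ (m ^ k)⁻¹ := inv_anti₀ (by positivity)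
        (pow_le_pow_of_le_one hm0.le hm1 ((card_le_card inter_subset_left).trans (hDk t)))
      calc (m ^ #(D t ∩ D t'))⁻¹ ≤ (m ^ k)⁻¹ * 1 := by rwa [mul_one]
        _ ≤ (m ^ k)⁻¹ * ∑ j ∈ D t, (if j ∈ F t' then (1 : ℝ) else 0) := by gcongr
        _ ≤ _ := by linarith
  -- Only overlapping pairs contribute to the variance, and no point of `D t` lies in `F'`, so each
  -- is requested with frequency below `η`.
  have hvar : ∀ v, subsetExp m (fun S => (∑ t, q v t * y t S - ∑ t, q v t) ^ 2) ≤
      (m ^ k)⁻¹ * (k * η) := by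
    intro v
    have h1 : (fun S => (∑ t, q v t * y t S - ∑ t, q v t) ^ 2) = fun S =>
        ((∑ t, ∑ t', q v t * q v t' * (y t S * y t' S)) -
          2 * (∑ t, q v t) * ∑ t, q v t * y t S) + (∑ t, q v t) ^ 2 := by
      funext S
      have : ∑ t, ∑ t', q v t * q v t' * (y t S * y t' S) = (∑ t, q v t * y t S) ^ 2 := by
        rw [sq, sum_mul_sum]
        exact sum_congr rfl fun t _ => sum_congr rfl fun t' _ => by ring
      rw [this]
      ring
    have h2 : subsetExp m (fun S => ∑ t, q v t * y t S) = ∑ t, q v t := by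
      rw [subsetExp_sum]
      simp_rw [subsetExp_const_mul]
      exact sum_congr rfl fun t _ => by rw [hEy, mul_one]
    have h3 : subsetExp m (fun S => ∑ t, ∑ t', q v t * q v t' * (y t S * y t' S)) =
        ∑ t, ∑ t', q v t * q v t' * subsetExp m (fun S => y t S * y t' S) := by
      rw [subsetExp_sum]
      simp_rw [subsetExp_sum, subsetExp_const_mul]
    rw [h1, subsetExp_add, subsetExp_sub, subsetExp_const_mul, h2, h3, subsetExp_const]
    have h4 : ∑ t, ∑ t', q v t * q v t' * subsetExp m (fun S => y t S * y t' S) ≤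
        (∑ t, q v t) ^ 2 + ∑ t, ∑ t', (m ^ k)⁻¹ *
          (p t * (p t' * ∑ j ∈ D t, if j ∈ F t' then (1 : ℝ) else 0)) := by
      rw [sq, sum_mul_sum, ← sum_add_distrib]
      refine sum_le_sum fun t _ => ?_
      rw [← sum_add_distrib]
      refine sum_le_sum fun t' _ => ?_
      have hsum0 : 0 ≤ ∑ j ∈ D t, (if j ∈ F t' then (1 : ℝ) else 0) :=
        sum_nonneg fun j _ => by split_ifs <;> simp
      calc q v t * q v t' * subsetExp m (fun S => y t S * y t' S)
          ≤ q v t * q v t' * (1 + (m ^ k)⁻¹ * ∑ j ∈ D t, if j ∈ F t' then (1 : ℝ) else 0) :=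
            mul_le_mul_of_nonneg_left (hEyy t t') (mul_nonneg (hq0 v t) (hq0 v t'))
        _ = q v t * q v t' + (m ^ k)⁻¹ * (q v t * (q v t' *
              ∑ j ∈ D t, if j ∈ F t' then (1 : ℝ) else 0)) := by ring
        _ ≤ _ := by
            gcongr
            exacts [mul_nonneg (hq0 v t') hsum0, hp0 t, hqp v t, hqp v t']
    have h5 : ∑ t, ∑ t', (m ^ k)⁻¹ * (p t * (p t' * ∑ j ∈ D t, if j ∈ F t' then (1 : ℝ) else 0)) ≤
        (m ^ k)⁻¹ * (k * η) := by
      simp_rw [← mul_sum]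
      gcongr
      calc ∑ t, p t * ∑ t', p t' * ∑ j ∈ D t, (if j ∈ F t' then (1 : ℝ) else 0)
          ≤ ∑ t, p t * (k * η) := by
            refine sum_le_sum fun t _ => mul_le_mul_of_nonneg_left ?_ (hp0 t)
            simp_rw [mul_sum]
            rw [sum_comm]
            calc ∑ j ∈ D t, ∑ t', p t' * (if j ∈ F t' then (1 : ℝ) else 0)
                ≤ ∑ j ∈ D t, η := by
                  refine sum_le_sum fun j hj => ?_
                  have := (mem_sdiff.1 hj).2
                  rw [hF', mem_filter] at this
                  push Not at this
                  exact (this (mem_univ j)).le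
              _ = #(D t) * η := by simp
              _ ≤ k * η := by
                  gcongr
                  exact hDk t
        _ = (∑ t, p t) * (k * η) := (sum_mul _ _ _).symm
        _ ≤ _ := mul_le_of_le_one_left (by positivity) hp1
    linarith
  -- The weight of those `t` whose requests are met although `S ∪ F t` is bad. Badness does not
  -- depend on `S` inside `D t ⊆ F t`, so the two events are independent.
  set Φ : Finset α → ℝ := fun S =>
    ∑ t, p t * ((m ^ #(D t))⁻¹ * ((if D t ⊆ S then 1 else 0) *
      Set.indicator {S | S ∪ F t ∉ good t} 1 S)) with hΦ
  have hEΦ : subsetExp m Φ ≤ κ * θ / 4 := by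
    have h1 : ∀ t, subsetExp m (fun S => (if D t ⊆ S then 1 else 0) *
        Set.indicator {S | S ∪ F t ∉ good t} 1 S) =
        m ^ #(D t) * subsetProb m {S | S ∪ F t ∉ good t} := by
      intro t
      refine subsetExp_subset_mul _ fun j hj S => ?_
      have : insert j S ∪ F t = S ∪ F t := by
        rw [insert_union, insert_eq_of_mem (mem_union_right _ (mem_sdiff.1 hj).1)]
      simp only [Set.indicator, Set.mem_ofPred_eq, this, Pi.one_apply]
    rw [hΦ, subsetExp_sum]
    simp_rw [subsetExp_const_mul, h1]
    calc ∑ t, p t * ((m ^ #(D t))⁻¹ * (m ^ #(D t) * subsetProb m {S | S ∪ F t ∉ good t}))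
        ≤ ∑ t, p t * (κ * θ / 4) := by
          refine sum_le_sum fun t _ => ?_
          rw [inv_mul_cancel_left₀ (by positivity)]
          by_cases h0 : p t = 0
          · simp [h0]
          · exact mul_le_mul_of_nonneg_left (hprob t h0) (hp0 t)
      _ = (∑ t, p t) * (κ * θ / 4) := (sum_mul _ _ _).symm
      _ ≤ _ := mul_le_of_le_one_left (by positivity) hp1
  -- If `D t ⊆ S`, then `S ∪ F t ⊆ S ∪ F'`; by monotonicity of `good`, a failure at `S ∪ F'` is
  -- already charged to `Φ`.
  have hkey : ∀ v S, m ^ k * (∑ t, q v t * y t S - Φ S) ≤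
      ∑ t, (good t).indicator (fun _ => q v t) (S ∪ F') := by
    intro v S
    rw [hΦ, ← sum_sub_distrib, mul_sum]
    refine sum_le_sum fun t _ => ?_
    by_cases hDS : D t ⊆ S
    · by_cases hg : S ∪ F' ∈ good t
      · rw [Set.indicator_of_mem hg]
        have h1 := mul_le_mul_of_nonneg_left (hyk t S) (hq0 v t)
        have h2 : 0 ≤ p t * ((m ^ #(D t))⁻¹ * ((if D t ⊆ S then 1 else 0) *
            Set.indicator {S | S ∪ F t ∉ good t} 1 S)) := by
          refine mul_nonneg (hp0 t) (mul_nonneg (by positivity) (mul_nonneg ?_ ?_))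
          · split_ifs
            simp
          · exact Set.indicator_nonneg (fun _ _ => zero_le_one) _
        have h3 := mul_nonneg (pow_nonneg hm0.le k) h2
        linarith
      · rw [Set.indicator_of_notMem hg]
        have hbad : S ∪ F t ∉ good t := by
          refine fun h => hg (hgood t _ _ ?_ h)
          refine union_subset subset_union_left fun j hj => ?_
          by_cases hj' : j ∈ F'
          · exact mem_union_right _ hj'
          · exact mem_union_left _ (hDS (mem_sdiff.2 ⟨hj, hj'⟩))
        rw [Set.indicator_of_mem (by exact hbad)]
        have : q v t * y t S ≤ p t * ((m ^ #(D t))⁻¹ * ((if D t ⊆ S then 1 else 0) *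
            (1 : Finset α → ℝ) S)) := by
          simp only [hy, Pi.one_apply, mul_one]
          exact mul_le_mul_of_nonneg_right (hqp v t) (hy0 t S)
        exact mul_nonpos_of_nonneg_of_nonpos (by positivity) (by linarith)
    · simp only [hy, hDS, if_false, mul_zero, zero_mul, sub_zero]
      exact Set.indicator_nonneg (fun _ _ => hq0 v t) _
  have hpoint : ∀ S, Set.indicator {S | ∃ v, ∑ t, (good t).indicator (fun _ => q v t) (S ∪ F') <
      m ^ k * (∑ t, q v t - θ)} 1 S ≤
      (∑ v, 4 / θ ^ 2 * (∑ t, q v t * y t S - ∑ t, q v t) ^ 2) + 2 / θ * Φ S := by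
    intro S
    have hΦ0 : 0 ≤ Φ S := by
      refine sum_nonneg fun t _ => mul_nonneg (hp0 t) (mul_nonneg (by positivity)
        (mul_nonneg ?_ ?_))
      · split_ifs <;> simp
      · exact Set.indicator_nonneg (fun _ _ => zero_le_one) _
    have hsq : ∀ v, 0 ≤ 4 / θ ^ 2 * (∑ t, q v t * y t S - ∑ t, q v t) ^ 2 :=
      fun v => by positivity
    by_cases hS : ∃ v, ∑ t, (good t).indicator (fun _ => q v t) (S ∪ F') <
        m ^ k * (∑ t, q v t - θ)
    · rw [Set.indicator_of_mem (by exact hS), Pi.one_apply]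
      obtain ⟨v, hv⟩ := hS
      by_cases hbig : θ / 2 ≤ Φ S
      · have h1 : 1 ≤ 2 / θ * Φ S := by
          rw [div_mul_eq_mul_div, le_div_iff₀ hθ]
          linarith
        have := sum_nonneg fun v (_ : v ∈ univ) => hsq v
        linarith
      · have h1 := lt_of_mul_lt_mul_left ((hkey v S).trans_lt hv) (pow_nonneg hm0.le k)
        have h2 : θ / 2 ≤ ∑ t, q v t - ∑ t, q v t * y t S := by linarith
        have h3 : 1 ≤ 4 / θ ^ 2 * (∑ t, q v t * y t S - ∑ t, q v t) ^ 2 := by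
          rw [div_mul_eq_mul_div, le_div_iff₀ (by positivity)]
          nlinarith
        have h4 := single_le_sum (fun v _ => hsq v) (mem_univ v)
        have h5 : 0 ≤ 2 / θ * Φ S := by positivity
        linarith
    · rw [Set.indicator_of_notMem (by exact hS)]
      have := sum_nonneg fun v (_ : v ∈ univ) => hsq v
      positivity
  calc _ ≤ subsetExp m (fun S =>
        (∑ v, 4 / θ ^ 2 * (∑ t, q v t * y t S - ∑ t, q v t) ^ 2) + 2 / θ * Φ S) :=
        subsetExp_mono hm0.le hm1 hpoint
    _ = (∑ v, 4 / θ ^ 2 * subsetExp m (fun S => (∑ t, q v t * y t S - ∑ t, q v t) ^ 2)) +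
          2 / θ * subsetExp m Φ := by
        rw [subsetExp_add, subsetExp_sum, subsetExp_const_mul]
        simp_rw [subsetExp_const_mul]
    _ ≤ (∑ v : ν, 4 / θ ^ 2 * ((m ^ k)⁻¹ * (k * η))) + 2 / θ * (κ * θ / 4) := by
        gcongr with v
        exact hvar v
    _ = (Fintype.card ν * k) / ((k + 1) * (n + 1)) * (κ / 2) + κ / 2 := by
        rw [sum_const, card_univ, nsmul_eq_mul, hη]
        field_simp
        ring
    _ ≤ 1 * (κ / 2) + κ / 2 := by
        gcongr
        rw [div_le_one (by positivity)]
        have hν' : (Fintype.card ν : ℝ) ≤ n := by exact_mod_cast hν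
        nlinarith [(Nat.cast_nonneg k : (0 : ℝ) ≤ k), (Nat.cast_nonneg n : (0 : ℝ) ≤ n)]
    _ = κ := by ring

end RandomSubset

/-! ### Forced cells: largeness of random preimages, by induction on the dimension. -/

section Forcing

open MeasureTheory Set

/-- A finite-valued function on an arbitrary set `E` is approximated by a measurable partition
`D` of a hull of `E`: the parts of the partition bound outer measures from below. -/
theorem exists_measurable_hull_partition {X τ : Type*} [MeasurableSpace X] [Fintype τ]
    (ν : Measure X) [IsProbabilityMeasure ν] (E : Set X) (T : X → τ) :
    ∃ D : τ → Set X,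
      (∀ V, MeasurableSet V → ν (E ∩ V) ≤ ENNReal.ofReal (∑ t, ν.real (D t ∩ V))) ∧
      (∀ V, MeasurableSet V → ∀ A : Set τ,
        ENNReal.ofReal (∑ t, A.indicator (fun t => ν.real (D t ∩ V)) t) ≤
          ν ((E ∩ T ⁻¹' A) ∩ V)) ∧
      ∑ t, ν.real (D t) ≤ 1 ∧ ∀ t, ν.real (D t) ≠ 0 → ∃ x ∈ E, T x = t := by
  classical
  let e := Fintype.equivFin τ
  -- Neither `E` nor the fibres of `T` need be measurable. Hulls of the pieces are made disjoint in
  -- the order given by `e`; restriction to the arbitrary set `M` below is additive on the resulting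
  -- measurable parts.
  let H : τ → Set X := fun t => toMeasurable ν (E ∩ T ⁻¹' {t})
  have hH : ∀ t, MeasurableSet (H t) := fun t => measurableSet_toMeasurable _ _
  let D : τ → Set X := fun t => H t \ ⋃ s ∈ {s | e s < e t}, H s
  have hD : ∀ t, MeasurableSet (D t) := fun t =>
    (hH t).diff (MeasurableSet.biUnion (to_countable _) fun s _ => hH s)
  have hlt : ∀ s t, e s < e t → Disjoint (D s) (D t) := by
    intro s t hst
    refine disjoint_left.2 fun x hx hx' => hx'.2 (mem_iUnion₂.2 ⟨s, hst, hx.1⟩)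
  have hdisj : Pairwise (Function.onFun Disjoint D) := by
    intro s t hst
    rcases lt_or_gt_of_ne (e.injective.ne hst) with h | h
    exacts [hlt s t h, (hlt t s h).symm]
  have hcover : E ⊆ ⋃ t, D t := by
    intro x hx
    have hxT : x ∈ H (T x) := subset_toMeasurable _ _ ⟨hx, rfl⟩
    obtain ⟨t, ht, hmin⟩ := (Set.toFinite {t | x ∈ H t}).exists_minimalFor e _ ⟨T x, hxT⟩
    refine mem_iUnion.2 ⟨t, ht, fun h => ?_⟩
    obtain ⟨s, hs, hxs⟩ := mem_iUnion₂.1 h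
    exact absurd (hmin hxs (le_of_lt hs)) (not_le.2 hs)
  have hsum : ∀ (s : Finset τ) (V : Set X), ENNReal.ofReal (∑ t ∈ s, ν.real (D t ∩ V)) =
      ∑ t ∈ s, ν (D t ∩ V) := by
    intro s V
    rw [ENNReal.ofReal_sum_of_nonneg fun _ _ => measureReal_nonneg]
    exact Finset.sum_congr rfl fun t _ => ofReal_measureReal
  refine ⟨D, ?_, ?_, ?_, ?_⟩
  · intro V _
    rw [hsum]
    calc ν (E ∩ V) ≤ ν (⋃ t, D t ∩ V) := by
          refine measure_mono ?_
          rw [← iUnion_inter]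
          exact inter_subset_inter_left _ hcover
      _ ≤ ∑ t, ν (D t ∩ V) := measure_iUnion_fintype_le _ _
  · intro V hV A
    have h1 : ∑ t, A.indicator (fun t => ν.real (D t ∩ V)) t =
        ∑ t with t ∈ A, ν.real (D t ∩ V) := by
      rw [Finset.sum_filter]
      exact Finset.sum_congr rfl fun t _ => by simp [indicator]
    rw [h1, hsum]
    set M := (E ∩ T ⁻¹' A) ∩ V with hM
    calc ∑ t with t ∈ A, ν (D t ∩ V) ≤ ∑ t with t ∈ A, (ν.restrict M) (D t) := by
          refine Finset.sum_le_sum fun t ht => ?_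
          have htA : t ∈ A := (Finset.mem_filter.1 ht).2
          have h2 : D t ∩ V = H t ∩ (D t ∩ V) :=
            (inter_eq_right.2 fun x hx => hx.1.1).symm
          rw [Measure.restrict_apply (hD t), h2,
            Measure.measure_toMeasurable_inter ((hD t).inter hV) (measure_ne_top _ _)]
          refine measure_mono ?_
          rintro x ⟨⟨hxE, hxT⟩, hxD, hxV⟩
          exact ⟨hxD, ⟨hxE, by rwa [mem_preimage, mem_singleton_iff.1 hxT]⟩, hxV⟩
      _ = (ν.restrict M) (⋃ t ∈ ({t | t ∈ A} : Finset τ), D t) :=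
          (measure_biUnion_finset (fun s _ t _ hst => hdisj hst) fun t _ => hD t).symm
      _ ≤ (ν.restrict M) univ := measure_mono (subset_univ _)
      _ = ν M := by simp
  · have h := measure_iUnion hdisj hD (μ := ν)
    rw [tsum_fintype] at h
    have h1 : ENNReal.ofReal (∑ t, ν.real (D t)) ≤ 1 := by
      have := hsum Finset.univ univ
      simp only [inter_univ] at this
      rw [this, ← h]
      exact prob_le_one
    simpa using h1
  · intro t ht
    by_contra! hne
    have h0 : E ∩ T ⁻¹' {t} = ∅ := by
      ext x
      simpa using fun hx => hne x hx
    refine ht ?_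
    have h2 : ν (D t) = 0 := by
      refine measure_mono_null sdiff_subset ?_
      simp [H, h0]
    simp [measureReal_def, h2]

/-- A strengthening of `Xi` without reference to the dimension-one case: `X` is nonempty, and the
set of first coordinates over which it is again large is robust. -/
def XiStrong (r δ ε : ℝ) : (d : ℕ) → (X Y : Set (Fin d → unitInterval)) → Prop
  | 0, X, _ => X.Nonempty
  | d + 1, X, Y => X.Nonempty ∧
      Robust r δ ε {x | XiStrong r δ ε d (cubeSection X x) (cubeSection Y x)}
        (hausdorffCapacity r (firstProj Y))

theorem cubeSection_mono {d : ℕ} {A B : Set (Fin (d + 1) → unitInterval)} (h : A ⊆ B)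
    (x : unitInterval) : cubeSection A x ⊆ cubeSection B x :=
  fun _ hy => h hy

theorem XiStrong.nonempty {r δ ε : ℝ} {d : ℕ} {X Y : Set (Fin d → unitInterval)}
    (h : XiStrong r δ ε d X Y) : X.Nonempty := by
  cases d with
  | zero => exact h
  | succ d => exact h.1

theorem XiStrong.mono {r δ δ' ε ε' : ℝ} (hδ : δ ≤ δ') (hε : ε' ≤ ε) {d : ℕ} :
    ∀ {X X' Y : Set (Fin d → unitInterval)}, X ⊆ X' → XiStrong r δ ε d X Y →
      XiStrong r δ' ε' d X' Y := by
  induction d with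
  | zero => exact fun hX h => Set.Nonempty.mono hX h
  | succ d ih =>
    intro X X' Y hX h
    exact ⟨h.1.mono hX, h.2.mono hδ hε (fun x hx => ih (cubeSection_mono hX x) hx) le_rfl⟩

/-- The preimage of a random subset of a finite set, together with a small forced set, is large
in the sense of `XiStrong` with high probability. -/
theorem XiStrong.exists_forced {r m : ℝ} (hr0 : 0 < r) (hr1 : r < 1) (hm0 : 0 < m) (hm1 : m ≤ 1)
    {δ ε : ℝ} (hδ : 0 < δ) (hε : 0 < ε) (d : ℕ) :
    ∀ κ : ℝ, 0 < κ → ∃ (k : ℕ) (ε' : ℝ), 0 < ε' ∧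
      ∀ (N : ℕ) (g : (Fin d → unitInterval) → Fin N) (δ₀ : ℝ), 0 ≤ δ₀ →
      ∀ X Y : Set (Fin d → unitInterval), XiStrong r δ₀ ε d X Y →
        ∃ F : Finset (Fin N), F.card ≤ k ∧
          subsetProb m {S | ¬ XiStrong r (δ₀ + δ) ε' d
            (X ∩ g ⁻¹' ((S ∪ F : Finset (Fin N)) : Set (Fin N))) Y} ≤ κ := by
  classical
  induction d with
  | zero =>
    intro κ hκ
    refine ⟨1, 1, one_pos, fun N g δ₀ _ X Y hX => ?_⟩
    obtain ⟨z, hz⟩ := hX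
    refine ⟨{g z}, by simp, ?_⟩
    have : {S | ¬ XiStrong r (δ₀ + δ) 1 0
        (X ∩ g ⁻¹' ((S ∪ {g z} : Finset (Fin N)) : Set (Fin N))) Y} = ∅ := by
      refine eq_empty_of_forall_notMem fun S hS => hS ⟨z, hz, by simp⟩
    rw [this, subsetProb, indicator_empty]
    simpa [subsetExp] using hκ.le
  | succ d ih =>
    intro κ hκ
    obtain ⟨k, ε₁, hε₁, hk⟩ := ih (κ * (ε / 2) / 4) (by positivity)
    obtain ⟨𝒱, h𝒱fin, h𝒱, ε₂, hε₂, htest⟩ :=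
      Robust.exists_finite_test hr0 hr1 hδ hε (pow_pos hm0 k)
    have := h𝒱fin.fintype
    obtain ⟨k', hk'⟩ := exists_forced_set hm0 hm1 (half_pos hε) hκ k (Fintype.card 𝒱)
    -- The extra cell `g z` keeps the preimage nonempty. The bounds are fixed before `N` and `g`, so
    -- the grid can later be refined at no cost.
    refine ⟨k' + 1, min ε₁ ε₂, lt_min hε₁ hε₂, fun N g δ₀ hδ₀ X Y hXY => ?_⟩
    obtain ⟨⟨z, hz⟩, hrob⟩ := hXY
    set E : Set unitInterval := {x | XiStrong r δ₀ ε d (cubeSection X x) (cubeSection Y x)}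
    have hF : ∀ x, ∃ F : Finset (Fin N), F.card ≤ k ∧ (x ∈ E →
        subsetProb m {S | ¬ XiStrong r (δ₀ + δ) ε₁ d (cubeSection X x ∩
          (fun y => g (Fin.cons x y)) ⁻¹' ((S ∪ F : Finset (Fin N)) : Set (Fin N)))
          (cubeSection Y x)} ≤ κ * (ε / 2) / 4) := by
      intro x
      by_cases hx : x ∈ E
      · obtain ⟨F, hFk, hFp⟩ := hk N (fun y => g (Fin.cons x y)) δ₀ hδ₀ _ _ hx
        exact ⟨F, hFk, fun _ => hFp⟩
      · exact ⟨∅, by simp, fun h => absurd h hx⟩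
    choose F hFk hFp using hF
    let good : unitInterval → Set (Finset (Fin N)) := fun x =>
      {S | XiStrong r (δ₀ + δ) ε₁ d (cubeSection X x ∩
        (fun y => g (Fin.cons x y)) ⁻¹' (S : Set (Fin N))) (cubeSection Y x)}
    have hgood : ∀ x S S', S ⊆ S' → S ∈ good x → S' ∈ good x := by
      intro x S S' hS h
      refine XiStrong.mono le_rfl le_rfl ?_ h
      exact inter_subset_inter_right _ (preimage_mono (by exact_mod_cast hS))
    -- For fixed `N` there are only finitely many pairs of a forced set and a family of good sets.
    -- Recording this pair reduces the sections over all `x` to a finite-valued function.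
    let τ := {t : Finset (Fin N) × Set (Finset (Fin N)) //
      t.1.card ≤ k ∧ ∀ S S', S ⊆ S' → S ∈ t.2 → S' ∈ t.2}
    let T : unitInterval → τ := fun x => ⟨(F x, good x), hFk x, hgood x⟩
    obtain ⟨D, hD1, hD2, hD3, hD4⟩ := exists_measurable_hull_partition volume E T
    obtain ⟨F', hF'k, hF'p⟩ := hk' (Fin N) τ 𝒱 le_rfl (fun t => volume.real (D t))
      (fun V t => volume.real (D t ∩ V)) (fun _ _ => measureReal_nonneg)
      (fun V t => measureReal_mono inter_subset_left) (fun _ => measureReal_nonneg) hD3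
      (fun t => t.1.1) (fun t => t.2.1) (fun t => t.1.2) (fun t => t.2.2)
      (by
        intro t ht
        obtain ⟨x, hx, rfl⟩ := hD4 t ht
        exact hFp x hx)
    refine ⟨F' ∪ {g z}, (Finset.card_union_le _ _).trans (by simpa using hF'k), ?_⟩
    refine (subsetProb_mono hm0.le hm1 ?_).trans hF'p
    intro S hS
    by_contra hcon
    have hcon' : ∀ V : 𝒱, (m ^ k) * (∑ t, volume.real (D t ∩ V) - ε / 2) ≤
        ∑ t : τ, t.1.2.indicator (fun _ => volume.real (D t ∩ V)) (S ∪ F') := by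
      intro V
      by_contra hV
      exact hcon ⟨V, not_le.1 hV⟩
    refine hS ⟨⟨z, hz, by simp⟩, ?_⟩
    have hG := htest δ₀ hδ₀ E (E ∩ T ⁻¹' {t | S ∪ F' ∈ t.1.2}) _ hrob ?_
    · refine hG.mono le_rfl (min_le_right _ _) ?_ le_rfl
      rintro x ⟨-, hx⟩
      refine XiStrong.mono le_rfl (min_le_left _ _) ?_ hx
      rintro y ⟨hyX, hyg⟩
      refine ⟨hyX, ?_⟩
      simp only [mem_preimage, Finset.coe_union] at hyg ⊢
      exact hyg.imp_right fun h => Or.inl h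
    -- The second moment bound says that the good part has density `m ^ k` in `E` on each test set,
    -- up to the error `m ^ k * (ε / 2)`.
    · intro V hV
      have h1 := hD1 V (h𝒱 V hV)
      have h2 := hD2 V (h𝒱 V hV) {t | S ∪ F' ∈ t.1.2}
      have h3 := hcon' ⟨V, hV⟩
      calc ENNReal.ofReal (m ^ k) * volume (E ∩ V)
          ≤ ENNReal.ofReal (m ^ k) * ENNReal.ofReal (∑ t, volume.real (D t ∩ V)) := by gcongr
        _ = ENNReal.ofReal (m ^ k * ∑ t, volume.real (D t ∩ V)) :=
            (ENNReal.ofReal_mul (by positivity)).symm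
        _ ≤ ENNReal.ofReal (∑ t : τ, Set.indicator {t : τ | S ∪ F' ∈ t.1.2}
              (fun t => volume.real (D t ∩ V)) t + m ^ k * (ε / 2)) := by
            refine ENNReal.ofReal_le_ofReal ?_
            have h4 : ∑ t : τ, Set.indicator {t : τ | S ∪ F' ∈ t.1.2}
                (fun t => volume.real (D t ∩ V)) t =
                ∑ t : τ, t.1.2.indicator (fun _ => volume.real (D t ∩ V)) (S ∪ F') :=
              Finset.sum_congr rfl fun t _ => by simp [indicator]
            rw [h4]
            linarith
        _ ≤ _ := ENNReal.ofReal_add_le.trans (by gcongr)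

end Forcing

/-! ### Largeness of the intersection of a normal family. -/

section NormalFamily

open MeasureTheory Set

variable {r δ ε : ℝ} {d : ℕ}

theorem mem_firstProj_iff {A : Set (Fin (d + 1) → unitInterval)} {x : unitInterval} :
    x ∈ firstProj A ↔ (cubeSection A x).Nonempty := by
  constructor
  · rintro ⟨z, hz, rfl⟩
    exact ⟨Fin.tail z, by simpa [cubeSection] using hz⟩
  · rintro ⟨y, hy⟩
    exact ⟨_, hy, rfl⟩

theorem firstProj_mono {A B : Set (Fin (d + 1) → unitInterval)} (h : A ⊆ B) :
    firstProj A ⊆ firstProj B :=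
  image_mono h

/-- Shrinking `Y` to `Y'` only lowers the capacity to be beaten, provided that `X` stays inside
`Y'`. Nonemptiness in `XiStrong` is what places the good coordinates in the projection of `Y'`. -/
theorem Xi.of_xiStrong : ∀ {d : ℕ} {X X' Y Y' : Set (Fin (d + 1) → unitInterval)},
    X ⊆ X' → X ⊆ Y' → Y' ⊆ Y → XiStrong r δ ε (d + 1) X Y → Xi r δ ε d X' Y' := by
  intro d
  induction d with
  | zero =>
    intro X X' Y Y' hX hXY hY h Z hZ
    refine (hausdorffCapacity_mono (firstProj_mono hY)).trans_lt ((h.2 Z hZ).trans_le ?_)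
    gcongr
    refine hausdorffCapacity_mono (sdiff_subset_sdiff_left fun x hx => ?_)
    have hx' := mem_firstProj_iff.2 (show (cubeSection X x).Nonempty from hx)
    exact ⟨firstProj_mono hX hx', firstProj_mono hXY hx'⟩
  | succ d ih =>
    intro X X' Y Y' hX hXY hY h Z hZ
    refine (hausdorffCapacity_mono (firstProj_mono hY)).trans_lt ((h.2 Z hZ).trans_le ?_)
    gcongr
    refine hausdorffCapacity_mono (sdiff_subset_sdiff_left fun x hx => ?_)
    have hx' := firstProj_mono hXY
      (mem_firstProj_iff.2 (XiStrong.nonempty (X := cubeSection X x) hx))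
    exact ⟨⟨hx', ih (cubeSection_mono hX x) (cubeSection_mono hXY x) (cubeSection_mono hY x) hx⟩,
      hx'⟩

theorem preimage_piFinSuccAbove_symm (A : Set (Fin (d + 1) → unitInterval)) (x : unitInterval) :
    Prod.mk x ⁻¹' ((MeasurableEquiv.piFinSuccAbove (fun _ : Fin (d + 1) => unitInterval) 0).symm ⁻¹'
      A) = cubeSection A x := by
  ext y
  simp only [mem_preimage, cubeSection, mem_ofPred_eq]
  rw [← Fin.insertNth_zero']
  rfl

theorem measurable_volume_cubeSection {A : Set (Fin (d + 1) → unitInterval)}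
    (hA : MeasurableSet A) : Measurable fun x => volume (cubeSection A x) := by
  simp_rw [← preimage_piFinSuccAbove_symm A]
  exact measurable_measure_prodMk_left ((MeasurableEquiv.measurable _) hA)

theorem volume_eq_lintegral_cubeSection {A : Set (Fin (d + 1) → unitInterval)}
    (hA : MeasurableSet A) : volume A = ∫⁻ x, volume (cubeSection A x) := by
  have hmp := (volume_preserving_piFinSuccAbove (fun _ : Fin (d + 1) => unitInterval) 0).symm
  rw [← hmp.measure_preimage_equiv A, Measure.volume_eq_prod,
    Measure.prod_apply ((MeasurableEquiv.measurable _) hA)]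
  simp_rw [preimage_piFinSuccAbove_symm A]

theorem cubeSection_cubeProj {n : ℕ} (h : n + 1 ≤ d + 1)
    (A : Set (Fin (d + 1) → unitInterval)) (x : unitInterval) :
    cubeSection (cubeProj (n + 1) h A) x =
      cubeProj n (Nat.le_of_succ_le_succ h) (cubeSection A x) := by
  ext y
  constructor
  · rintro ⟨z, hz, hzy⟩
    have h0 : z 0 = x := congrFun hzy 0
    refine ⟨Fin.tail z, ?_, ?_⟩
    · show Fin.cons x (Fin.tail z) ∈ A
      rwa [← h0, Fin.cons_self_tail]
    · funext i
      exact congrFun hzy i.succ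
  · rintro ⟨w, hw, rfl⟩
    refine ⟨_, hw, ?_⟩
    funext i
    refine Fin.cases ?_ (fun j => ?_) i
    · rfl
    · simp

theorem cubeProj_mono {n : ℕ} (h : n ≤ d) {A B : Set (Fin d → unitInterval)} (hAB : A ⊆ B) :
    cubeProj n h A ⊆ cubeProj n h B :=
  image_mono hAB

theorem continuous_cubeRestrict {n : ℕ} (h : n ≤ d) :
    Continuous fun (z : Fin d → unitInterval) (i : Fin n) => z (Fin.castLE h i) := by
  fun_prop

theorem isClosed_cubeProj {n : ℕ} (h : n ≤ d) {A : Set (Fin d → unitInterval)}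
    (hA : IsClosed A) : IsClosed (cubeProj n h A) :=
  (hA.isCompact.image (continuous_cubeRestrict h)).isClosed

/-- If the projections of `K ⊆ C` have almost full measure in those of `C`, then so do the
projections of most sections. -/
theorem exists_exceptional_sections {K C : Set (Fin (d + 1) → unitInterval)} (hK : IsClosed K)
    (hC : IsClosed C) {η η' : ℝ≥0∞} (hη' : η' ≠ 0) (hη'top : η' ≠ ∞)
    (h : ∀ n (hn : n ≤ d + 1), 1 ≤ n → volume (cubeProj n hn C \ cubeProj n hn K) ≤ η) :
    ∃ B : Set unitInterval, volume B ≤ (d + 1) * (η / η') ∧ ∀ x ∉ B, ∀ n (hn : n ≤ d),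
      volume (cubeProj n hn (cubeSection C x) \ cubeProj n hn (cubeSection K x)) < η' := by
  -- Fubini and Markov's inequality bound each `A n` by `η / η'`.
  let A : Fin (d + 1) → Set unitInterval := fun n => {x | η' ≤ volume (cubeSection
    (cubeProj (n + 1) n.isLt C \ cubeProj (n + 1) n.isLt K) x)}
  refine ⟨⋃ n, A n, ?_, ?_⟩
  · calc volume (⋃ n, A n) ≤ ∑ n, volume (A n) := measure_iUnion_fintype_le _ _
      _ ≤ ∑ _n : Fin (d + 1), η / η' := by
          refine Finset.sum_le_sum fun n _ => ?_
          have hmeas : MeasurableSet (cubeProj (n + 1) n.isLt C \ cubeProj (n + 1) n.isLt K) :=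
            (isClosed_cubeProj _ hC).measurableSet.diff (isClosed_cubeProj _ hK).measurableSet
          refine (meas_ge_le_lintegral_div (measurable_volume_cubeSection hmeas).aemeasurable
            hη' hη'top).trans ?_
          rw [← volume_eq_lintegral_cubeSection hmeas]
          gcongr
          exact h _ _ (Nat.le_add_left 1 n)
      _ = (d + 1) * (η / η') := by simp
  · intro x hx n hn
    have : x ∉ A ⟨n, Nat.lt_succ_of_le hn⟩ := fun h => hx (mem_iUnion.2 ⟨_, h⟩)
    rw [← cubeSection_cubeProj (Nat.succ_le_succ hn), ← cubeSection_cubeProj (Nat.succ_le_succ hn)]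
    exact not_le.1 this

/-- The exceptional set `B` is removed together with `Z`, each using up half of `ε`. -/
theorem XiOne.robust {E E' Y B : Set unitInterval} (h : XiOne r δ ε E Y) (hε : 0 < ε)
    (hB : volume B ≤ ENNReal.ofReal (ε / 2)) (hE : (E ∩ Y) \ B ⊆ E') :
    Robust r δ (ε / 2) E' (hausdorffCapacity r Y) := by
  intro Z hZ
  have hZB : volume (B ∪ Z) < ENNReal.ofReal ε := by
    calc volume (B ∪ Z) ≤ volume B + volume Z := measure_union_le _ _
      _ < ENNReal.ofReal (ε / 2) + ENNReal.ofReal (ε / 2) :=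
          ENNReal.add_lt_add_of_le_of_lt (measure_ne_top _ _) hB hZ
      _ = ENNReal.ofReal ε := by
          rw [← ENNReal.ofReal_add (by positivity) (by positivity), add_halves]
  refine (h _ hZB).trans_le ?_
  gcongr
  refine hausdorffCapacity_mono ?_
  rw [← sdiff_sdiff]
  exact sdiff_subset_sdiff_left hE

/-- Self-largeness of `C` passes to closed subsets with projections of almost full measure. -/
theorem XiStrong.of_xi (d : ℕ) : ∀ {ε : ℝ}, 0 < ε → ∃ η : ℝ, 0 < η ∧
    ∀ K C : Set (Fin (d + 1) → unitInterval), IsClosed K → IsClosed C → K.Nonempty →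
      (∀ n (hn : n ≤ d + 1), 1 ≤ n →
        volume (cubeProj n hn C \ cubeProj n hn K) ≤ ENNReal.ofReal η) →
      Xi r δ ε d C C → XiStrong r δ (ε / 2) (d + 1) K C := by
  -- The zero-dimensional cube is a point of measure one, so a defect of measure below one is no
  -- defect at all.
  have hlift : ∀ (d : ℕ) (K C : Set (Fin d → unitInterval)) (η : ℝ≥0∞), η ≤ 1 →
      volume (cubeProj 0 d.zero_le C \ cubeProj 0 d.zero_le K) < η → C.Nonempty →
      K.Nonempty := by
    intro d K C η hη h hC
    by_contra hK
    rw [not_nonempty_iff_eq_empty] at hK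
    obtain ⟨z, hz⟩ := hC
    have huniv : cubeProj 0 d.zero_le C \ cubeProj 0 d.zero_le K = univ := by
      refine eq_univ_of_forall fun y => ⟨⟨z, hz, Subsingleton.elim _ _⟩, ?_⟩
      rw [hK]
      rintro ⟨w, hw, -⟩
      exact hw
    rw [huniv, measure_univ] at h
    exact absurd hη (not_le.2 h)
  have hbound : ∀ (d : ℕ) {ε η' : ℝ}, 0 < ε → 0 < η' →
      ((d : ℝ≥0∞) + 1) * (ENNReal.ofReal (η' * (ε / 2 / (d + 1))) / ENNReal.ofReal η') ≤
        ENNReal.ofReal (ε / 2) := by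
    intro d ε η' hε hη'
    rw [← ENNReal.ofReal_div_of_pos hη', mul_div_cancel_left₀ _ hη'.ne',
      ← Nat.cast_add_one, ← ENNReal.ofReal_natCast, ← ENNReal.ofReal_mul (by positivity)]
    refine ENNReal.ofReal_le_ofReal (le_of_eq ?_)
    push_cast
    field_simp
  induction d with
  | zero =>
    intro ε hε
    refine ⟨1 * (ε / 2 / ((0 : ℕ) + 1)), by positivity, ?_⟩
    intro K C hK hC hKne h hXi
    obtain ⟨B, hB, hBx⟩ := exists_exceptional_sections hK hC (η' := ENNReal.ofReal 1)
      (by simp) (by simp) h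
    refine ⟨hKne, XiOne.robust hXi hε (hB.trans (hbound 0 hε one_pos)) ?_⟩
    rintro x ⟨⟨hx, -⟩, hxB⟩
    exact hlift _ _ _ _ (by simp) (hBx x hxB 0 le_rfl) (mem_firstProj_iff.1 hx)
  | succ d ih =>
    intro ε hε
    obtain ⟨η, hη, hind⟩ := ih hε
    have hη' : 0 < min η 1 := lt_min hη one_pos
    refine ⟨min η 1 * (ε / 2 / ((d + 1 : ℕ) + 1)), by positivity, ?_⟩
    intro K C hK hC hKne h hXi
    obtain ⟨B, hB, hBx⟩ := exists_exceptional_sections hK hC (η' := ENNReal.ofReal (min η 1))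
      (by simpa using hη) (by simp) h
    refine ⟨hKne, XiOne.robust hXi hε (hB.trans (hbound _ hε hη')) ?_⟩
    rintro x ⟨⟨⟨hxC, hx⟩, -⟩, hxB⟩
    have hcont : Continuous fun y : Fin (d + 1) → unitInterval =>
        (Fin.cons x y : Fin (d + 2) → unitInterval) := by fun_prop
    refine hind _ _ (hK.preimage hcont) (hC.preimage hcont)
      (hlift _ _ _ _ (by simp) (hBx x hxB 0 (Nat.zero_le _)) (mem_firstProj_iff.1 hxC)) ?_ hx
    intro n hn _
    exact (hBx x hxB n hn).le.trans (ENNReal.ofReal_le_ofReal (min_le_left _ _))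

theorem IsElementary.isClosed : ∀ {d : ℕ} {X : Set (Fin (d + 1) → unitInterval)},
    IsElementary d X → IsClosed X := by
  intro d
  induction d with
  | zero =>
    rintro X ⟨k, p, q, -, rfl⟩
    have : {z : Fin 1 → unitInterval | ∃ i, (p i : ℝ) ≤ (z 0 : ℝ) ∧ (z 0 : ℝ) ≤ (q i : ℝ)} =
        ⋃ i, {z | (p i : ℝ) ≤ (z 0 : ℝ)} ∩ {z | (z 0 : ℝ) ≤ (q i : ℝ)} := by
      ext z
      simp
    rw [this]
    refine isClosed_iUnion_of_finite fun i => IsClosed.inter ?_ ?_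
    · exact isClosed_le (by fun_prop) (by fun_prop)
    · exact isClosed_le (by fun_prop) (by fun_prop)
  | succ d ih =>
    rintro X ⟨k, p, q, S, -, hS, rfl⟩
    have : {z : Fin (d + 2) → unitInterval | ∃ i, (p i : ℝ) ≤ (z 0 : ℝ) ∧
        (z 0 : ℝ) ≤ (q i : ℝ) ∧ (fun j => z (Fin.succ j)) ∈ S i} =
        ⋃ i, ({z | (p i : ℝ) ≤ (z 0 : ℝ)} ∩ {z | (z 0 : ℝ) ≤ (q i : ℝ)}) ∩
          (fun (z : Fin (d + 2) → unitInterval) (j : Fin (d + 1)) => z (Fin.succ j)) ⁻¹' S i := by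
      ext z
      simp [and_assoc]
    rw [this]
    refine isClosed_iUnion_of_finite fun i => IsClosed.inter (IsClosed.inter ?_ ?_) ?_
    · exact isClosed_le (by fun_prop) (by fun_prop)
    · exact isClosed_le (by fun_prop) (by fun_prop)
    · exact (ih (hS i)).preimage (by fun_prop)

theorem IsElementaryList.exists_mem {k : ℕ} {p q : Fin (k + 1) → ℚ} (h : IsElementaryList p q)
    (i : Fin (k + 1)) : ∃ x : unitInterval, (p i : ℝ) ≤ x ∧ (x : ℝ) ≤ q i := by
  have h1 : (p i : ℝ) ≤ q i := by exact_mod_cast (h.lt i).le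
  have h2 : (q i : ℝ) ≤ 1 := by exact_mod_cast h.le_one i
  exact ⟨⟨p i, by exact_mod_cast h.nonneg i, h1.trans h2⟩, le_rfl, h1⟩

theorem IsElementary.nonempty : ∀ {d : ℕ} {X : Set (Fin (d + 1) → unitInterval)},
    IsElementary d X → X.Nonempty := by
  intro d
  induction d with
  | zero =>
    rintro X ⟨k, p, q, h, rfl⟩
    obtain ⟨x, hx⟩ := h.exists_mem 0
    exact ⟨fun _ => x, 0, hx⟩
  | succ d ih =>
    rintro X ⟨k, p, q, S, h, hS, rfl⟩
    obtain ⟨x, hx⟩ := h.exists_mem 0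
    obtain ⟨y, hy⟩ := ih (hS 0)
    exact ⟨Fin.cons x y, 0, hx.1, hx.2, by simpa using hy⟩

variable {C : ℕ → Set (Fin (d + 1) → unitInterval)}

theorem IsNormalFamily.antitone (h : IsNormalFamily r d C) : Antitone C :=
  antitone_nat_of_succ_le h.subset

theorem IsNormalFamily.isClosed (h : IsNormalFamily r d C) (i : ℕ) : IsClosed (C i) :=
  (h.elementary i).isClosed

theorem IsNormalFamily.nonempty_iInter (h : IsNormalFamily r d C) : (⋂ i, C i).Nonempty :=
  IsCompact.nonempty_iInter_of_sequence_nonempty_isCompact_isClosed C h.subset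
    (fun i => (h.elementary i).nonempty) (h.isClosed 0).isCompact h.isClosed

/-- By compactness, the decreasing fibres of the `C i` over a common projected point have a common
element. -/
theorem IsNormalFamily.iInter_cubeProj_subset (h : IsNormalFamily r d C) {n : ℕ}
    (hn : n ≤ d + 1) : ⋂ i, cubeProj n hn (C i) ⊆ cubeProj n hn (⋂ i, C i) := by
  intro x hx
  have hcl : IsClosed {z : Fin (d + 1) → unitInterval | (fun i => z (Fin.castLE hn i)) = x} :=
    isClosed_eq (continuous_cubeRestrict hn) continuous_const
  obtain ⟨z, hz⟩ := IsCompact.nonempty_iInter_of_sequence_nonempty_isCompact_isClosed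
    (fun i => C i ∩ {z | (fun i => z (Fin.castLE hn i)) = x})
    (fun i => inter_subset_inter_left _ (h.subset i))
    (fun i => by
      obtain ⟨z, hz, hzx⟩ := mem_iInter.1 hx i
      exact ⟨z, hz, hzx⟩)
    ((h.isClosed 0).inter hcl).isCompact (fun i => (h.isClosed i).inter hcl)
  rw [mem_iInter] at hz
  exact ⟨z, mem_iInter.2 fun i => (hz i).1, (hz 0).2⟩

theorem IsNormalFamily.volume_cubeProj_diff_le (h : IsNormalFamily r d C) (J : ℕ) {n : ℕ}
    (hn : n ≤ d + 1) (h1 : 1 ≤ n) :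
    volume (cubeProj n hn (C J) \ cubeProj n hn (⋂ i, C i)) ≤ (2⁻¹ : ℝ≥0∞) ^ J := by
  have hsub : cubeProj n hn (C J) \ cubeProj n hn (⋂ i, C i) ⊆
      ⋃ i, (cubeProj n hn (C (J + i)) \ cubeProj n hn (C (J + i + 1))) := by
    rintro x ⟨hxJ, hx⟩
    by_contra hcon
    have hall : ∀ i, x ∈ cubeProj n hn (C (J + i)) := by
      intro i
      induction i with
      | zero => exact hxJ
      | succ i ih =>
        by_contra hi
        exact hcon (mem_iUnion.2 ⟨i, ih, hi⟩)
    refine hx (h.iInter_cubeProj_subset hn (mem_iInter.2 fun i => ?_))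
    exact cubeProj_mono hn (h.antitone (Nat.le_add_left i J)) (hall i)
  calc volume (cubeProj n hn (C J) \ cubeProj n hn (⋂ i, C i))
      ≤ ∑' i, volume (cubeProj n hn (C (J + i)) \ cubeProj n hn (C (J + i + 1))) :=
        (measure_mono hsub).trans (measure_iUnion_le _)
    _ ≤ ∑' i, (2⁻¹ : ℝ≥0∞) ^ (J + 1) * 2⁻¹ ^ i * 2⁻¹ := by
        refine ENNReal.tsum_le_tsum fun i => (h.measure_diff (J + i) n hn h1).le.trans ?_
        calc volume (cubeProj n hn (C (J + i))) / 2 ^ (J + i + 2)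
            ≤ 1 / 2 ^ (J + i + 2) := by
              gcongr
              exact prob_le_one
          _ = _ := by
              rw [one_div, ENNReal.inv_pow, ← pow_add, ← pow_succ]
              congr 1
              omega
    _ = 2⁻¹ ^ (J + 1) := by
        rw [ENNReal.tsum_mul_right, ENNReal.tsum_mul_left, ENNReal.tsum_geometric,
          ENNReal.one_sub_inv_two, inv_inv, mul_assoc, ENNReal.mul_inv_cancel (by simp) (by simp),
          mul_one]
    _ ≤ _ := pow_le_pow_of_le_one zero_le (by simp) (Nat.le_succ J)

end NormalFamily

/-! ### No generator covers `W_n`. -/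

section Properness

open MeasureTheory Set

variable {r δ : ℝ} {d : ℕ}

theorem biUnion_cells_mem_WFamily {n N : ℕ} (T : Finset (Fin N)) (hT : T.Nonempty)
    (hcard : (T.card : ℝ) / N < (2 ^ n)⁻¹) :
    (⋃ j ∈ T, {t : unitInterval | (j : ℝ) / N ≤ t ∧ (t : ℝ) ≤ (j + 1) / N}) ∈ WFamily n := by
  obtain ⟨j₀, hj₀⟩ := hT
  have hN : (0 : ℝ) < N := by exact_mod_cast j₀.pos
  obtain ⟨k, hk⟩ : ∃ k, T.card = k + 1 :=
    Nat.exists_eq_succ_of_ne_zero (Finset.card_ne_zero_of_mem hj₀)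
  let e : Fin (k + 1) ≃ T := (T.equivFinOfCardEq hk).symm
  let cell : Fin N → Set unitInterval :=
    fun j => {t | (j : ℝ) / N ≤ t ∧ (t : ℝ) ≤ (j + 1) / N}
  have hj1 : ∀ j : Fin N, ((j : ℝ) + 1) / N ≤ 1 := fun j => by
    rw [div_le_one hN]
    exact_mod_cast j.isLt
  have hlt : ∀ j : Fin N, (j : ℝ) / N < ((j : ℝ) + 1) / N := fun j => by gcongr; linarith
  have hvol : ∀ j, volume (cell j) = ENNReal.ofReal (1 / N) := by
    intro j
    have h0 : (0 : ℝ) ≤ (j : ℝ) / N := by positivity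
    have hcell : cell j = Icc ⟨(j : ℝ) / N, h0, (hlt j).le.trans (hj1 j)⟩
        ⟨((j : ℝ) + 1) / N, h0.trans (hlt j).le, hj1 j⟩ := rfl
    rw [hcell, unitInterval.volume_Icc]
    congr 1
    simp only
    ring
  refine ⟨k, fun i => cell (e i), fun i => ?_, ?_, ?_⟩
  · refine ⟨((e i : Fin N) : ℚ) / N, (((e i : Fin N) : ℚ) + 1) / N, by positivity, ?_, ?_, ?_, ?_⟩
    · have hNq : (0 : ℚ) < N := by exact_mod_cast hN
      gcongr
      linarith
    · have hNq : (0 : ℚ) < N := by exact_mod_cast hN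
      rw [div_le_one hNq]
      exact_mod_cast (e i : Fin N).isLt
    · rintro t ⟨h1, h2⟩
      push_cast at h1 h2
      exact ⟨h1.le, h2.le⟩
    · rintro t ⟨h1, h2⟩
      push_cast
      exact ⟨h1, h2⟩
  · simp_rw [hvol]
    rw [Finset.sum_const, Finset.card_univ, Fintype.card_fin, ← hk, nsmul_eq_mul,
      ← ENNReal.ofReal_natCast, ← ENNReal.ofReal_mul (by positivity), mul_one_div]
    calc ENNReal.ofReal ((T.card : ℝ) / N) < ENNReal.ofReal (2 ^ n)⁻¹ :=
          (ENNReal.ofReal_lt_ofReal_iff (by positivity)).2 hcard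
      _ = (2 ^ n)⁻¹ := by
          rw [ENNReal.ofReal_inv_of_pos (by positivity), ENNReal.ofReal_pow (by norm_num)]
          simp
  · ext t
    simp only [mem_iUnion]
    constructor
    · rintro ⟨j, hj, ht⟩
      exact ⟨e.symm ⟨j, hj⟩, by simpa [cell] using ht⟩
    · rintro ⟨i, hi⟩
      exact ⟨e i, (e i).2, hi⟩

/-- A generator does not contain all of `W_n`. -/
theorem not_WFamily_subset_generatorSet (hr0 : 0 < r) (hr1 : r < 1) (n : ℕ)
    (f : C(Fin (d + 1) → unitInterval, unitInterval)) {C : ℕ → Set (Fin (d + 1) → unitInterval)}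
    (hC : IsNormalFamily r d C) (hδ : 0 < δ) : ¬ WFamily n ⊆ generatorSet r n f C δ := by
  classical
  obtain ⟨i, hi⟩ := exists_nat_gt (2 / δ)
  have hi0 : (0 : ℝ) < i := lt_trans (by positivity) hi
  have hiδ : 1 / (i : ℝ) ≤ δ / 2 := by
    rw [div_lt_iff₀ hδ] at hi
    rw [div_le_iff₀ hi0]
    linarith
  obtain ⟨β, hβ, hXi⟩ := hC.witness i (by exact_mod_cast hi0)
  obtain ⟨η, hη, hstrong⟩ := XiStrong.of_xi (r := r) (δ := 1 / (i : ℝ)) d hβ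
  obtain ⟨J₀, hJ₀⟩ := ENNReal.exists_inv_two_pow_lt (a := ENNReal.ofReal η) (by simpa using hη)
  set J := max i J₀
  set K := ⋂ j, C j
  have hJ : (2⁻¹ : ℝ≥0∞) ^ J ≤ ENNReal.ofReal η :=
    (pow_le_pow_of_le_one zero_le (by simp) (le_max_right i J₀)).trans hJ₀.le
  have hK : XiStrong r (1 / (i : ℝ)) (β / 2) (d + 1) K (C J) :=
    hstrong K (C J) (isClosed_iInter hC.isClosed) (hC.isClosed J) hC.nonempty_iInter
      (fun m hm h1 => (hC.volume_cubeProj_diff_le J hm h1).trans hJ) (hXi J (le_max_left _ _))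
  set w : ℝ := (2 ^ n)⁻¹ with hw
  have hw0 : 0 < w := by positivity
  have hw1 : w ≤ 1 := inv_le_one_of_one_le₀ (one_le_pow₀ (by norm_num))
  have hm0 : 0 < w / 8 := by positivity
  obtain ⟨k, ε', hε', hforce⟩ := XiStrong.exists_forced hr0 hr1 hm0 (by linarith)
    (half_pos hδ) (half_pos hβ) (d + 1) (1 / 4) (by norm_num)
  obtain ⟨N, hN⟩ := exists_nat_gt (((k : ℝ) + 1) / (w / 4))
  have hN0 : (0 : ℝ) < N := lt_trans (by positivity) hN
  have hN0' : 0 < N := by exact_mod_cast hN0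
  have hNk : ((k : ℝ) + 1) / N < w / 4 := by
    rw [div_lt_iff₀ (by positivity)] at hN
    rw [div_lt_iff₀ hN0]
    linarith
  -- The index of a cell containing `f z`; the minimum puts the value `1` into the last cell.
  let g : (Fin (d + 1) → unitInterval) → Fin N := fun z =>
    ⟨min ⌊(f z : ℝ) * N⌋₊ (N - 1), lt_of_le_of_lt (min_le_right _ _) (Nat.sub_lt hN0' one_pos)⟩
  have hg : ∀ z, ((g z : ℕ) : ℝ) / N ≤ f z ∧ (f z : ℝ) ≤ ((g z : ℕ) + 1) / N := by
    intro z
    have h0 : (0 : ℝ) ≤ f z * N := mul_nonneg (f z).2.1 hN0.le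
    have h1 : (f z : ℝ) * N ≤ N := mul_le_of_le_one_left hN0.le (f z).2.2
    rw [div_le_iff₀ hN0, le_div_iff₀ hN0]
    constructor
    · refine le_trans ?_ (Nat.floor_le h0)
      exact_mod_cast min_le_left _ _
    · rcases min_choice ⌊(f z : ℝ) * N⌋₊ (N - 1) with h | h
      · simp only [g, h]
        exact (Nat.lt_floor_add_one _).le
      · simp only [g, h]
        rw [Nat.cast_sub hN0']
        simpa using h1
  obtain ⟨F, hFk, hF⟩ := hforce N g _ (by positivity) K (C J) hK
  -- The bad event has probability at most `1/4`. Since the expected size of `S` is `w / 8 * N`,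
  -- Markov's inequality gives at most `1/2` for exceeding `w / 4 * N`.
  obtain ⟨S, hS, hScard⟩ : ∃ S : Finset (Fin N), XiStrong r (1 / (i : ℝ) + δ / 2) ε' (d + 1)
      (K ∩ g ⁻¹' ((S ∪ F : Finset (Fin N)) : Set (Fin N))) (C J) ∧
      (S.card : ℝ) ≤ w / 4 * N := by
    by_contra! hcon
    have h1 : (1 : ℝ) ≤ subsetExp (α := Fin N) (w / 8) (fun S =>
        Set.indicator {S | ¬ XiStrong r (1 / (i : ℝ) + δ / 2) ε' (d + 1)
          (K ∩ g ⁻¹' ((S ∪ F : Finset (Fin N)) : Set (Fin N))) (C J)} 1 S +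
          (w / 4 * N)⁻¹ * S.card) := by
      refine (subsetExp_const (α := Fin N) (m := w / 8) 1).symm.le.trans
        (subsetExp_mono hm0.le (by linarith) fun S => ?_)
      by_cases hS : XiStrong r (1 / (i : ℝ) + δ / 2) ε' (d + 1)
          (K ∩ g ⁻¹' ((S ∪ F : Finset (Fin N)) : Set (Fin N))) (C J)
      · have h2 : 1 ≤ (w / 4 * N)⁻¹ * S.card := by
          rw [inv_mul_eq_div, one_le_div (by positivity)]
          exact (hcon S hS).le
        exact h2.trans (le_add_of_nonneg_left (indicator_nonneg (fun _ _ => zero_le_one) _))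
      · rw [indicator_of_mem (by exact hS)]
        exact le_add_of_nonneg_right (by positivity)
    rw [subsetExp_add, subsetExp_const_mul, subsetExp_card, Fintype.card_fin] at h1
    have h3 : (w / 4 * N)⁻¹ * (w / 8 * N) = 1 / 2 := by
      field_simp
      norm_num
    rw [h3] at h1
    have h4 : subsetExp (w / 8) (Set.indicator {S : Finset (Fin N) |
        ¬ XiStrong r (1 / (i : ℝ) + δ / 2) ε' (d + 1)
          (K ∩ g ⁻¹' ((S ∪ F : Finset (Fin N)) : Set (Fin N))) (C J)} 1) ≤ 1 / 4 := hF
    linarith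
  -- The additional cell only ensures that the union is nonempty, as membership in `W_n` needs at
  -- least one interval.
  set T : Finset (Fin N) := insert ⟨0, hN0'⟩ (S ∪ F) with hT
  set a : Set unitInterval :=
    ⋃ j ∈ T, {t : unitInterval | (j : ℝ) / N ≤ t ∧ (t : ℝ) ≤ (j + 1) / N} with ha
  have haW : a ∈ WFamily n := by
    refine biUnion_cells_mem_WFamily T (Finset.insert_nonempty _ _) ?_
    have h1 : (T.card : ℝ) ≤ S.card + k + 1 := by
      have := (Finset.card_insert_le (⟨0, hN0'⟩ : Fin N) (S ∪ F)).trans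
        (Nat.add_le_add_right (Finset.card_union_le S F) 1)
      exact_mod_cast this.trans (by omega)
    calc (T.card : ℝ) / N ≤ (w / 4 * N + (k + 1)) / N := by gcongr; linarith
      _ = w / 4 + (k + 1) / N := by field_simp
      _ < w := by linarith
  intro hsub
  refine (hsub haW).2 ε' hε' ((finite_Iio J).subset fun j hj => ?_)
  by_contra hjJ
  refine hj (Xi.of_xiStrong (X := K ∩ f ⁻¹' a) (Y := C J) inter_subset_right
    (inter_subset_left.trans (iInter_subset _ j)) (hC.antitone (not_lt.1 hjJ)) ?_)
  refine XiStrong.mono (by linarith) le_rfl ?_ hS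
  rintro z ⟨hzK, hz⟩
  exact ⟨hzK, mem_iUnion₂.2 ⟨g z, Finset.mem_insert_of_mem hz, hg z⟩⟩

end Properness

/-! ### Mass distribution, and unions of generators. -/

section Ideal

open MeasureTheory Set unitInterval

variable {r δ δ' ε ε' : ℝ} {d : ℕ}

theorem XiOne.mono {X X' Y : Set unitInterval} (hδ : δ ≤ δ') (hε : ε' ≤ ε) (hX : X ⊆ X')
    (h : XiOne r δ ε X Y) : XiOne r δ' ε' X' Y := by
  intro Z hZ
  refine (h Z (hZ.trans_le (ENNReal.ofReal_le_ofReal hε))).trans_le ?_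
  exact add_le_add (hausdorffCapacity_mono
    (sdiff_subset_sdiff_left (inter_subset_inter_left _ hX))) (ENNReal.ofReal_le_ofReal hδ)

theorem Xi.mono (hδ : δ ≤ δ') (hε : ε' ≤ ε) : ∀ {d : ℕ} {X Y : Set (Fin (d + 1) → unitInterval)},
    Xi r δ ε d X Y → Xi r δ' ε' d X Y := by
  intro d
  induction d with
  | zero => exact fun h => XiOne.mono hδ hε le_rfl h
  | succ d ih => exact fun h => XiOne.mono hδ hε (fun x hx => ⟨hx.1, ih hx.2⟩) h

/-- The mass distribution principle. -/
theorem volume_le_mul_hausdorffCapacity {P X : Set unitInterval} {c : ℝ≥0∞}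
    (hc0 : c ≠ 0) (hc : c ≠ ∞)
    (hP : ∀ J : Set unitInterval, J.OrdConnected → volume (J ∩ P) ≤ c * volume J ^ r)
    (hX : X ⊆ P) : volume X ≤ c * hausdorffCapacity r X := by
  rw [← ENNReal.div_le_iff' hc0 hc]
  refine le_iInf fun J => le_iInf fun hJ => le_iInf fun hcov => ?_
  rw [ENNReal.div_le_iff' hc0 hc]
  calc volume X ≤ volume (⋃ i, J i ∩ P) := by
        refine measure_mono fun x hx => ?_
        obtain ⟨i, hi⟩ := mem_iUnion.1 (hcov hx)
        exact mem_iUnion.2 ⟨i, hi, hX hx⟩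
    _ ≤ ∑' i, volume (J i ∩ P) := measure_iUnion_le _
    _ ≤ ∑' i, c * volume (J i) ^ r := ENNReal.tsum_le_tsum fun i => hP _ (hJ i)
    _ = _ := ENNReal.tsum_mul_left

/-- A set of capacity one that carries a suitable mass distribution is robust in itself. -/
theorem XiOne.self_of_mass (hr : 0 < r) {P : Set unitInterval} {c : ℝ} (hc : 0 < c)
    (hP : ∀ J : Set unitInterval, J.OrdConnected →
      volume (J ∩ P) ≤ ENNReal.ofReal c * volume J ^ r)
    (hvol : ENNReal.ofReal c ≤ volume P) : XiOne r δ (c * δ) P P := by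
  intro Z hZ
  refine (hausdorffCapacity_le_one hr P).trans_lt ?_
  have hc0 : ENNReal.ofReal c ≠ 0 := by simpa using hc
  -- After removal of `Z` more than `c - c * δ` of the mass is left, and mass divided by `c` bounds
  -- capacity from below.
  have h1 : ENNReal.ofReal c * 1 <
      ENNReal.ofReal c * (hausdorffCapacity r (P \ Z) + ENNReal.ofReal δ) := by
    calc ENNReal.ofReal c * 1 ≤ volume P := by rwa [mul_one]
      _ ≤ volume (P \ Z) + volume Z := by
          refine (measure_mono (subset_union_left (t := Z))).trans ?_
          rw [← sdiff_union_self]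
          exact measure_union_le _ _
      _ < volume (P \ Z) + ENNReal.ofReal (c * δ) :=
          ENNReal.add_lt_add_left (measure_ne_top _ _) hZ
      _ ≤ ENNReal.ofReal c * hausdorffCapacity r (P \ Z) + ENNReal.ofReal (c * δ) := by
          gcongr
          exact volume_le_mul_hausdorffCapacity hc0 ENNReal.ofReal_ne_top hP sdiff_subset
      _ = _ := by rw [mul_add, ENNReal.ofReal_mul hc.le]
  rw [inter_self]
  exact lt_of_mul_lt_mul_left' h1

theorem volume_inter_univ_le_rpow (hr1 : r < 1) (J : Set unitInterval) :
    volume (J ∩ univ) ≤ ENNReal.ofReal 1 * volume J ^ r := by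
  rw [inter_univ, ENNReal.ofReal_one, one_mul]
  calc volume J = volume J ^ (1 : ℝ) := (ENNReal.rpow_one _).symm
    _ ≤ volume J ^ r := ENNReal.rpow_le_rpow_of_exponent_ge prob_le_one hr1.le

/-- The set `[0, p] ∪ [1 - p, 1]`. -/
def outerIntervals (p : unitInterval) : Set unitInterval := Iic p ∪ Ici (σ p)

theorem volume_outerIntervals {p : unitInterval} (hp : (p : ℝ) < 1 / 2) :
    volume (outerIntervals p) = ENNReal.ofReal (2 * p) := by
  have hdisj : Disjoint (Iic p) (Ici (σ p)) := by
    refine disjoint_left.2 fun x (hx : x ≤ p) (hx' : σ p ≤ x) => ?_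
    have := Subtype.coe_le_coe.2 (hx'.trans hx)
    rw [coe_symm_eq] at this
    linarith
  rw [outerIntervals, measure_union hdisj measurableSet_Ici, volume_Iic, volume_Ici, coe_symm_eq,
    ← ENNReal.ofReal_add p.2.1 (by simpa using p.2.1)]
  congr 1
  ring

/-- With `t` the length of `J`: if `J` meets one of the intervals, the left side is at most `min t
p`, and `2p^r ≥ 1` suffices. If it meets both, it contains the gap, and `t - (1 - 2p) ≤ 2pt ≤ 2pt^r`
because `t ≤ 1`. -/
theorem volume_inter_outerIntervals_le (hr0 : 0 < r) (hr1 : r < 1) {p : unitInterval}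
    (hp0 : 0 < (p : ℝ)) (hp : (p : ℝ) < 1 / 2) (hpr : 1 ≤ 2 * (p : ℝ) ^ r) {J : Set unitInterval}
    (hJ : J.OrdConnected) :
    volume (J ∩ outerIntervals p) ≤ ENNReal.ofReal (2 * p) * volume J ^ r := by
  set t : ℝ := volume.real J with ht
  have htJ : volume J = ENNReal.ofReal t := (ofReal_measureReal (μ := volume)).symm
  have ht0 : 0 ≤ t := measureReal_nonneg
  have ht1 : t ≤ 1 := by
    rw [← ENNReal.ofReal_le_one, ← htJ]
    exact prob_le_one
  have hrhs : ENNReal.ofReal (2 * p) * volume J ^ r = ENNReal.ofReal (2 * p * t ^ r) := by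
    rw [htJ, ENNReal.ofReal_rpow_of_nonneg ht0 hr0.le, ← ENNReal.ofReal_mul (by positivity)]
  have hmin : min t p ≤ 2 * p * t ^ r := by
    rcases le_total t p with h | h
    · rw [min_eq_left h]
      rcases ht0.eq_or_lt with h0 | h0
      · rw [← h0]
        positivity
      · calc t = t ^ (1 - r) * t ^ r := by rw [← Real.rpow_add h0]; simp
          _ ≤ (p : ℝ) ^ (1 - r) * t ^ r := by
              gcongr
          _ ≤ (p : ℝ) ^ (1 - r) * (2 * (p : ℝ) ^ r) * t ^ r := by
              gcongr
              exact le_mul_of_one_le_right (by positivity) hpr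
          _ = 2 * ((p : ℝ) ^ (1 - r) * (p : ℝ) ^ r) * t ^ r := by ring
          _ = 2 * p * t ^ r := by rw [← Real.rpow_add hp0]; simp
    · rw [min_eq_right h]
      calc (p : ℝ) ≤ p * (2 * (p : ℝ) ^ r) := le_mul_of_one_le_right hp0.le hpr
        _ = 2 * p * (p : ℝ) ^ r := by ring
        _ ≤ 2 * p * t ^ r := by gcongr
  have hone : ∀ Q : Set unitInterval, volume Q = ENNReal.ofReal p → J ∩ outerIntervals p ⊆ Q →
      volume (J ∩ outerIntervals p) ≤ ENNReal.ofReal (2 * p) * volume J ^ r := by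
    intro Q hQ hsub
    rw [hrhs]
    refine le_trans ?_ (ENNReal.ofReal_le_ofReal hmin)
    rw [ENNReal.ofReal_min, ← htJ, ← hQ]
    exact le_min (measure_mono inter_subset_left) (measure_mono hsub)
  by_cases hlow : (J ∩ Iic p).Nonempty
  · by_cases hupp : (J ∩ Ici (σ p)).Nonempty
    · obtain ⟨x, hxJ, hx⟩ := hlow
      obtain ⟨y, hyJ, hy⟩ := hupp
      have hgap : Ioo p (σ p) ⊆ J := fun z hz =>
        hJ.out hxJ hyJ ⟨(show x ≤ p from hx).trans hz.1.le, hz.2.le.trans hy⟩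
      have hdisj : Disjoint (J ∩ outerIntervals p) (Ioo p (σ p)) := by
        refine disjoint_left.2 ?_
        rintro z ⟨-, hz | hz⟩ hz'
        exacts [not_lt.2 hz hz'.1, not_lt.2 hz hz'.2]
      have h1 : volume (J ∩ outerIntervals p) + ENNReal.ofReal (1 - 2 * p) ≤
          ENNReal.ofReal t := by
        rw [← htJ, show (1 - 2 * p : ℝ) = (σ p : ℝ) - p by rw [coe_symm_eq]; ring, ← volume_Ioo,
          ← measure_union hdisj measurableSet_Ioo]
        exact measure_mono (union_subset inter_subset_left hgap)
      have h2 : volume.real (J ∩ outerIntervals p) + (1 - 2 * p) ≤ t := by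
        rw [← ofReal_measureReal (μ := volume), ← ENNReal.ofReal_add measureReal_nonneg
          (by linarith)] at h1
        exact (ENNReal.ofReal_le_ofReal_iff ht0).1 h1
      rw [hrhs, ← ofReal_measureReal (μ := volume)]
      refine ENNReal.ofReal_le_ofReal ?_
      have h3 : t ≤ t ^ r := by
        simpa using Real.rpow_le_rpow_of_exponent_ge' ht0 ht1 hr0.le hr1.le
      nlinarith
    · refine hone (Iic p) (volume_Iic p) ?_
      rintro x ⟨hxJ, hx | hx⟩
      exacts [hx, absurd ⟨x, hxJ, hx⟩ hupp]
  · refine hone (Ici (σ p)) (by rw [volume_Ici, coe_symm_eq, sub_sub_cancel]) ?_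
    rintro x ⟨hxJ, hx | hx⟩
    exacts [absurd ⟨x, hxJ, hx⟩ hlow, hx]

theorem exists_rat_outerIntervals (hr0 : 0 < r) (hr1 : r < 1) :
    ∃ q : ℚ, 0 < (q : ℝ) ∧ (q : ℝ) < 1 / 2 ∧ 1 ≤ 2 * (q : ℝ) ^ r := by
  have h1 : ((1 : ℝ) / 2) ^ r⁻¹ < 1 / 2 := by
    have := Real.rpow_lt_rpow_of_exponent_gt (x := (1 : ℝ) / 2) (by norm_num) (by norm_num)
      ((one_lt_inv₀ hr0).2 hr1)
    simpa using this
  obtain ⟨q, hq, hq'⟩ := exists_rat_btwn h1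
  have h0 : (0 : ℝ) < ((1 : ℝ) / 2) ^ r⁻¹ := by positivity
  refine ⟨q, h0.trans hq, hq', ?_⟩
  have h2 := Real.rpow_le_rpow h0.le hq.le hr0.le
  rw [Real.rpow_inv_rpow (by norm_num) hr0.ne'] at h2
  linarith

/-- The set with section `A` over `[0, p]` and section `B` over `[1 - p, 1]`. -/
def sideBySide (p : unitInterval) (A B : Set (Fin d → unitInterval)) :
    Set (Fin (d + 1) → unitInterval) :=
  {z | z 0 ≤ p ∧ Fin.tail z ∈ A ∨ σ p ≤ z 0 ∧ Fin.tail z ∈ B}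

/-! ### Two families side by side in one more dimension. -/

section SideBySide

variable {p : unitInterval}

theorem not_symm_le_of_le (hp : (p : ℝ) < 1 / 2) {x : unitInterval} (hx : x ≤ p) : ¬ σ p ≤ x := by
  intro hx'
  have := Subtype.coe_le_coe.2 (hx'.trans hx)
  rw [coe_symm_eq] at this
  linarith

theorem cubeSection_sideBySide_of_le (hp : (p : ℝ) < 1 / 2) (A B : Set (Fin d → unitInterval))
    {x : unitInterval} (hx : x ≤ p) : cubeSection (sideBySide p A B) x = A := by
  ext y
  simp [cubeSection, sideBySide, hx, not_symm_le_of_le hp hx]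

theorem cubeSection_sideBySide_of_ge (hp : (p : ℝ) < 1 / 2) (A B : Set (Fin d → unitInterval))
    {x : unitInterval} (hx : σ p ≤ x) : cubeSection (sideBySide p A B) x = B := by
  have hx' : ¬ x ≤ p := fun h => not_symm_le_of_le hp h hx
  ext y
  simp [cubeSection, sideBySide, hx, hx']

theorem firstProj_sideBySide {A B : Set (Fin d → unitInterval)} (hA : A.Nonempty)
    (hB : B.Nonempty) : firstProj (sideBySide p A B) = outerIntervals p := by
  obtain ⟨a, ha⟩ := hA
  obtain ⟨b, hb⟩ := hB
  ext x
  constructor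
  · rintro ⟨z, hz | hz, rfl⟩
    exacts [Or.inl hz.1, Or.inr hz.1]
  · rintro (hx | hx)
    · exact ⟨Fin.cons x a, Or.inl ⟨hx, by simpa using ha⟩, rfl⟩
    · exact ⟨Fin.cons x b, Or.inr ⟨hx, by simpa using hb⟩, rfl⟩

theorem sideBySide_mono {A A' B B' : Set (Fin d → unitInterval)} (hA : A ⊆ A') (hB : B ⊆ B') :
    sideBySide p A B ⊆ sideBySide p A' B' :=
  fun _ hz => hz.imp (And.imp_right fun h => hA h) (And.imp_right fun h => hB h)

theorem sideBySide_sdiff (hp : (p : ℝ) < 1 / 2) (A A' B B' : Set (Fin d → unitInterval)) :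
    sideBySide p A B \ sideBySide p A' B' = sideBySide p (A \ A') (B \ B') := by
  ext z
  by_cases hz : z 0 ≤ p
  · simp [sideBySide, hz, not_symm_le_of_le hp hz]
  · by_cases hz' : σ p ≤ z 0 <;> simp [sideBySide, hz, hz']

theorem cubeProj_sideBySide {n : ℕ} (h : n + 1 ≤ d + 1) (A B : Set (Fin d → unitInterval)) :
    cubeProj (n + 1) h (sideBySide p A B) =
      sideBySide p (cubeProj n (Nat.le_of_succ_le_succ h) A)
        (cubeProj n (Nat.le_of_succ_le_succ h) B) := by
  ext y
  constructor
  · rintro ⟨z, hz, rfl⟩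
    exact hz.imp (fun h => ⟨h.1, _, h.2, rfl⟩) (fun h => ⟨h.1, _, h.2, rfl⟩)
  · have key : ∀ w : Fin d → unitInterval,
        (fun i => w (Fin.castLE (Nat.le_of_succ_le_succ h) i)) = Fin.tail y →
        (fun i => (Fin.cons (y 0) w : Fin (d + 1) → unitInterval) (Fin.castLE h i)) = y := by
      intro w hw
      funext i
      refine Fin.cases rfl (fun j => ?_) i
      exact congrFun hw j
    rintro (⟨h0, w, hw, hwy⟩ | ⟨h0, w, hw, hwy⟩)
    · exact ⟨_, Or.inl ⟨h0, by simpa using hw⟩, key w hwy⟩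
    · exact ⟨_, Or.inr ⟨h0, by simpa using hw⟩, key w hwy⟩

theorem volume_sideBySide (hp : (p : ℝ) < 1 / 2) {A B : Set (Fin d → unitInterval)}
    (hB : MeasurableSet B) :
    volume (sideBySide p A B) = ENNReal.ofReal p * (volume A + volume B) := by
  have hmp := volume_preserving_piFinSuccAbove (fun _ : Fin (d + 1) => unitInterval) 0
  have heq : sideBySide p A B = (MeasurableEquiv.piFinSuccAbove
      (fun _ : Fin (d + 1) => unitInterval) 0) ⁻¹' (Iic p ×ˢ A ∪ Ici (σ p) ×ˢ B) := rfl
  rw [heq, hmp.measure_preimage_equiv, measure_union, Measure.volume_eq_prod, Measure.prod_prod,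
    Measure.prod_prod, volume_Iic, volume_Ici, coe_symm_eq, sub_sub_cancel, mul_add]
  · refine disjoint_left.2 ?_
    rintro ⟨x, y⟩ ⟨hx, -⟩ ⟨hx', -⟩
    exact not_symm_le_of_le hp hx hx'
  · exact measurableSet_Ici.prod hB

theorem IsElementary.sideBySide {q : ℚ} (hpq : (p : ℝ) = q) (hp0 : 0 < (p : ℝ))
    (hp : (p : ℝ) < 1 / 2) {A B : Set (Fin (d + 1) → unitInterval)} (hA : IsElementary d A)
    (hB : IsElementary d B) : IsElementary (d + 1) (sideBySide p A B) := by
  have hq0 : 0 < q := by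
    rw [hpq] at hp0
    exact_mod_cast hp0
  have hq : q < 1 / 2 := by
    rw [hpq, show (1 / 2 : ℝ) = ((1 / 2 : ℚ) : ℝ) by norm_num] at hp
    exact_mod_cast hp
  refine ⟨1, ![0, 1 - q], ![q, 1], ![A, B], ⟨?_, ?_, ?_, ?_⟩, ?_, ?_⟩
  · intro i
    fin_cases i <;> simp
    linarith
  · intro i
    fin_cases i <;> simp
    linarith
  · intro i
    fin_cases i <;> simp <;> linarith
  · intro i j hij
    fin_cases i <;> fin_cases j <;> simp at hij ⊢
    linarith
  · intro i
    fin_cases i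
    exacts [hA, hB]
  · ext z
    have h0 : (0 : ℝ) ≤ z 0 := (z 0).2.1
    have h1 : (z 0 : ℝ) ≤ 1 := (z 0).2.2
    have hle : z 0 ≤ p ↔ (z 0 : ℝ) ≤ q := by rw [← Subtype.coe_le_coe, hpq]
    have hge : σ p ≤ z 0 ↔ (1 - q : ℝ) ≤ z 0 := by rw [← Subtype.coe_le_coe, coe_symm_eq, hpq]
    constructor
    · rintro (⟨hz, hzA⟩ | ⟨hz, hzB⟩)
      · exact ⟨0, by simpa using h0, by simpa using hle.1 hz, hzA⟩
      · exact ⟨1, by simpa using hge.1 hz, by simpa using h1, hzB⟩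
    · rintro ⟨i, hi, hi', hz⟩
      fin_cases i
      · exact Or.inl ⟨hle.2 (by simpa using hi'), hz⟩
      · exact Or.inr ⟨hge.2 (by simpa using hi), hz⟩

theorem IsNormalFamily.sideBySide (hr0 : 0 < r) (hr1 : r < 1) {q : ℚ} (hpq : (p : ℝ) = q)
    (hp0 : 0 < (p : ℝ)) (hp : (p : ℝ) < 1 / 2) (hpr : 1 ≤ 2 * (p : ℝ) ^ r)
    {C₁ C₂ : ℕ → Set (Fin (d + 1) → unitInterval)} (h₁ : IsNormalFamily r d C₁)
    (h₂ : IsNormalFamily r d C₂) :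
    IsNormalFamily r (d + 1) (fun i => sideBySide p (C₁ i) (C₂ i)) := by
  refine ⟨fun i => (h₁.elementary i).sideBySide hpq hp0 hp (h₂.elementary i),
    fun i => sideBySide_mono (h₁.subset i) (h₂.subset i), ?_, ?_⟩
  · intro i n hn h1
    obtain ⟨m, rfl⟩ := Nat.exists_eq_succ_of_ne_zero (Nat.one_le_iff_ne_zero.1 h1)
    have hm : m ≤ d + 1 := Nat.le_of_succ_le_succ hn
    have hdiff : ∀ {C : ℕ → Set (Fin (d + 1) → unitInterval)}, IsNormalFamily r d C →
        volume (cubeProj m hm (C i) \ cubeProj m hm (C (i + 1))) <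
          volume (cubeProj m hm (C i)) / 2 ^ (i + 2) := by
      intro C hC
      -- The first coordinate of the new family corresponds to `m = 0`, where the given families
      -- impose no condition; there the projections never change.
      rcases Nat.eq_zero_or_pos m with rfl | hm0
      · have huniv : ∀ j, cubeProj 0 hm (C j) = univ := fun j => by
          obtain ⟨z, hz⟩ := (hC.elementary j).nonempty
          exact eq_univ_of_forall fun y => ⟨z, hz, Subsingleton.elim _ _⟩
        rw [huniv, huniv, Set.sdiff_self, measure_empty, measure_univ]
        exact ENNReal.div_pos one_ne_zero (by simp)
      · exact hC.measure_diff i m hm hm0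
    have hmeas : ∀ {C : ℕ → Set (Fin (d + 1) → unitInterval)}, IsNormalFamily r d C → ∀ j,
        MeasurableSet (cubeProj m hm (C j)) :=
      fun hC j => (isClosed_cubeProj hm (hC.isClosed j)).measurableSet
    rw [cubeProj_sideBySide, cubeProj_sideBySide, sideBySide_sdiff hp,
      volume_sideBySide hp ((hmeas h₂ _).diff (hmeas h₂ _)),
      volume_sideBySide hp (hmeas h₂ _), mul_div_assoc, ENNReal.add_div]
    exact ENNReal.mul_lt_mul_right (by simpa using hp0) ENNReal.ofReal_ne_top
      (ENNReal.add_lt_add (hdiff h₁) (hdiff h₂))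
  · intro i hi
    obtain ⟨β₁, hβ₁, hX₁⟩ := h₁.witness i hi
    obtain ⟨β₂, hβ₂, hX₂⟩ := h₂.witness i hi
    have hi0 : (0 : ℝ) < 1 / i := by
      have : (0 : ℝ) < i := by exact_mod_cast hi
      positivity
    refine ⟨min (min β₁ β₂) (2 * p * (1 / i)), by positivity, fun j hj => ?_⟩
    have hproj := firstProj_sideBySide (p := p) (h₁.elementary j).nonempty
      (h₂.elementary j).nonempty
    have hself : XiOne r (1 / i) (2 * p * (1 / i)) (outerIntervals p) (outerIntervals p) :=
      XiOne.self_of_mass hr0 (by positivity)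
        (fun J hJ => volume_inter_outerIntervals_le hr0 hr1 hp0 hp hpr hJ)
        (volume_outerIntervals hp).ge
    rw [Xi, hproj]
    refine hself.mono le_rfl (min_le_right _ _) ?_
    rintro x (hx | hx)
    · refine ⟨Or.inl hx, ?_⟩
      rw [cubeSection_sideBySide_of_le hp _ _ hx]
      exact (hX₁ j hj).mono le_rfl ((min_le_left _ _).trans (min_le_left _ _))
    · refine ⟨Or.inr hx, ?_⟩
      rw [cubeSection_sideBySide_of_ge hp _ _ hx]
      exact (hX₂ j hj).mono le_rfl ((min_le_left _ _).trans (min_le_right _ _))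

/-- The ramp `φ` is one on `[0,p]` and zero on `[1-p,1]`; cutting off with lattice operations keeps
values in the unit interval. -/
theorem exists_continuousMap_sideBySide (hp : (p : ℝ) < 1 / 2)
    (f₁ f₂ : C(Fin d → unitInterval, unitInterval)) :
    ∃ f : C(Fin (d + 1) → unitInterval, unitInterval),
      (∀ x y, x ≤ p → f (Fin.cons x y) = f₁ y) ∧ ∀ x y, σ p ≤ x → f (Fin.cons x y) = f₂ y := by
  have h0 : (0 : ℝ) < 1 - 2 * p := by linarith
  let φ : C(unitInterval, unitInterval) :=
    ⟨fun x => projIcc 0 1 zero_le_one ((1 - p - x) / (1 - 2 * p)), by fun_prop⟩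
  refine ⟨⟨fun z => (f₁ (Fin.tail z) ⊓ φ (z 0)) ⊔ (f₂ (Fin.tail z) ⊓ σ (φ (z 0))), ?_⟩, ?_, ?_⟩
  · have : Continuous fun z : Fin (d + 1) → unitInterval => Fin.tail z := by
      unfold Fin.tail
      fun_prop
    fun_prop
  · intro x y hx
    have hx' : (x : ℝ) ≤ p := hx
    have : φ x = 1 := projIcc_of_right_le zero_le_one (by
      rw [le_div_iff₀ h0]
      linarith)
    simp [this, le_one']
  · intro x y hx
    have hx' : (1 - p : ℝ) ≤ x := by
      rw [← coe_symm_eq]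
      exact hx
    have : φ x = 0 := projIcc_of_le_left zero_le_one (div_nonpos_of_nonpos_of_nonneg
      (by linarith) h0.le)
    simp [this, le_one']

end SideBySide

/-- `Y` is contained in a generator of dimension `d + 1`. -/
def IsSmall (r : ℝ) (n d : ℕ) (Y : Set (Set unitInterval)) : Prop :=
  ∃ (f : C(Fin (d + 1) → unitInterval, unitInterval))
    (C : ℕ → Set (Fin (d + 1) → unitInterval)) (δ : ℝ),
    0 < δ ∧ IsNormalFamily r d C ∧ Y ⊆ generatorSet r n f C δ

theorem IsSmall.union_of_eq_dim (hr0 : 0 < r) (hr1 : r < 1) {n : ℕ} {Y₁ Y₂ : Set (Set unitInterval)}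
    (h₁ : IsSmall r n d Y₁) (h₂ : IsSmall r n d Y₂) : IsSmall r n (d + 1) (Y₁ ∪ Y₂) := by
  obtain ⟨f₁, C₁, δ₁, hδ₁, hC₁, hY₁⟩ := h₁
  obtain ⟨f₂, C₂, δ₂, hδ₂, hC₂, hY₂⟩ := h₂
  obtain ⟨q, hq0, hq, hqr⟩ := exists_rat_outerIntervals hr0 hr1
  obtain ⟨p, hpq⟩ : ∃ p : unitInterval, (p : ℝ) = q := ⟨⟨q, hq0.le, by linarith⟩, rfl⟩
  rw [← hpq] at hq0 hq hqr
  obtain ⟨f, hf₁, hf₂⟩ := exists_continuousMap_sideBySide hq f₁ f₂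
  have hpr1 : (p : ℝ) ^ r < 1 := Real.rpow_lt_one hq0.le (by linarith) hr0
  set δ := min (min δ₁ δ₂) (1 - (p : ℝ) ^ r) with hδ
  have hcap : 1 ≤ hausdorffCapacity r (outerIntervals p) := by
    have h := volume_le_mul_hausdorffCapacity (r := r) (X := outerIntervals p)
      (c := ENNReal.ofReal (2 * p)) (by simpa using hq0) ENNReal.ofReal_ne_top
      (fun J hJ => volume_inter_outerIntervals_le hr0 hr1 hq0 hq hqr hJ) le_rfl
    rw [volume_outerIntervals hq] at h
    by_contra! hlt
    refine absurd h (not_le.2 ?_)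
    simpa using ENNReal.mul_lt_mul_right (a := ENNReal.ofReal (2 * p)) (by simpa using hq0)
      ENNReal.ofReal_ne_top hlt
  -- If all good coordinates lay in `Q`, their capacity would be at most `p ^ r`, which together
  -- with the slack does not exceed one, the capacity of the whole projection.
  have hfail : ∀ {ε : ℝ} {a : Set unitInterval} {i : ℕ} {Q : Set unitInterval}, 0 < ε →
      Q.OrdConnected → volume Q = ENNReal.ofReal p →
      Xi r δ ε (d + 1) (f ⁻¹' a) (sideBySide p (C₁ i) (C₂ i)) →
      ∃ x ∈ outerIntervals p, x ∉ Q ∧ Xi r δ ε d (cubeSection (f ⁻¹' a) x)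
        (cubeSection (sideBySide p (C₁ i) (C₂ i)) x) := by
    intro ε a i Q hε hQ hQvol hXi
    by_contra! hcon
    rw [Xi, firstProj_sideBySide (hC₁.elementary i).nonempty (hC₂.elementary i).nonempty] at hXi
    refine absurd (hXi ∅ (by simpa using hε)) (not_lt.2 (le_trans ?_ hcap))
    calc _ ≤ hausdorffCapacity r Q + ENNReal.ofReal (1 - (p : ℝ) ^ r) := by
          refine add_le_add (hausdorffCapacity_mono ?_)
            (ENNReal.ofReal_le_ofReal (min_le_right _ _))
          rintro x ⟨⟨⟨hx, hxXi⟩, -⟩, -⟩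
          by_contra hxQ
          exact hcon x hx hxQ hxXi
      _ ≤ ENNReal.ofReal ((p : ℝ) ^ r) + ENNReal.ofReal (1 - (p : ℝ) ^ r) := by
          gcongr
          rw [← ENNReal.ofReal_rpow_of_pos hq0, ← hQvol]
          exact hausdorffCapacity_le_of_ordConnected hr0 hQ
      _ = 1 := by
          rw [← ENNReal.ofReal_add (by positivity) (by linarith), add_sub_cancel,
            ENNReal.ofReal_one]
  refine ⟨f, fun i => sideBySide p (C₁ i) (C₂ i), δ,
    lt_min (lt_min hδ₁ hδ₂) (sub_pos.2 hpr1),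
    hC₁.sideBySide hr0 hr1 hpq hq0 hq hqr hC₂, union_subset ?_ ?_⟩
  · intro a ha
    obtain ⟨haW, ha⟩ := hY₁ ha
    refine ⟨haW, fun ε hε => (ha ε hε).mono fun i (hi : ¬ Xi r δ₁ ε d (f₁ ⁻¹' a) (C₁ i)) hXi => hi ?_⟩
    obtain ⟨x, hx, hxI, hxXi⟩ := hfail hε ordConnected_Ici
      (by rw [volume_Ici, coe_symm_eq, sub_sub_cancel]) hXi
    have hxp : x ≤ p := hx.resolve_right hxI
    rw [cubeSection_sideBySide_of_le hq _ _ hxp] at hxXi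
    have heq : cubeSection (f ⁻¹' a) x = f₁ ⁻¹' a := by
      ext y
      simp [cubeSection, hf₁ x y hxp]
    rw [heq] at hxXi
    exact hxXi.mono ((min_le_left _ _).trans (min_le_left _ _)) le_rfl
  · intro a ha
    obtain ⟨haW, ha⟩ := hY₂ ha
    refine ⟨haW, fun ε hε => (ha ε hε).mono fun i (hi : ¬ Xi r δ₂ ε d (f₂ ⁻¹' a) (C₂ i)) hXi => hi ?_⟩
    obtain ⟨x, hx, hxI, hxXi⟩ := hfail hε ordConnected_Iic (volume_Iic p) hXi
    have hxp : σ p ≤ x := hx.resolve_left hxI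
    rw [cubeSection_sideBySide_of_ge hq _ _ hxp] at hxXi
    have heq : cubeSection (f ⁻¹' a) x = f₂ ⁻¹' a := by
      ext y
      simp [cubeSection, hf₂ x y hxp]
    rw [heq] at hxXi
    exact hxXi.mono ((min_le_left _ _).trans (min_le_right _ _)) le_rfl

theorem IsSmall.mono_dim (hr0 : 0 < r) (hr1 : r < 1) {n d' : ℕ} {Y : Set (Set unitInterval)}
    (h : IsSmall r n d Y) (hd : d ≤ d') : IsSmall r n d' Y := by
  induction d', hd using Nat.le_induction with
  | base => exact h
  | succ d' _ ih => simpa using ih.union_of_eq_dim hr0 hr1 ih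

theorem isNormalFamily_univ (hr0 : 0 < r) (hr1 : r < 1) :
    IsNormalFamily r 0 (fun _ => univ) := by
  refine ⟨fun _ => ⟨0, fun _ => 0, fun _ => 1, ⟨?_, ?_, ?_, ?_⟩, ?_⟩, fun _ => le_rfl, ?_, ?_⟩
  · simp
  · simp
  · simp
  · intro i j hij
    exact absurd (Fin.lt_def.1 hij) (by omega)
  · ext z
    simp [(z 0).2.1, (z 0).2.2]
  · intro i n hn h1
    obtain rfl : n = 1 := le_antisymm hn h1
    have huniv : cubeProj 1 hn univ = univ := eq_univ_of_forall fun y => ⟨y, trivial, rfl⟩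
    rw [Set.sdiff_self, measure_empty, huniv, measure_univ]
    exact ENNReal.div_pos one_ne_zero (by simp)
  · intro i hi
    have hi0 : (0 : ℝ) < 1 / i := by
      have : (0 : ℝ) < i := by exact_mod_cast hi
      positivity
    refine ⟨1 * (1 / i), by positivity, fun j _ => ?_⟩
    have huniv : firstProj (univ : Set (Fin (0 + 1) → unitInterval)) = univ :=
      eq_univ_of_forall fun x => ⟨fun _ => x, trivial, rfl⟩
    rw [Xi, huniv]
    exact XiOne.self_of_mass hr0 one_pos (fun J _ => volume_inter_univ_le_rpow hr1 J) (by simp)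

/-- Since `a` has measure below one, it misses a point `c`. The constant map `c` has empty preimage
of `a`, and slack one does not make up for the capacity of the full interval. -/
theorem isSmall_singleton (hr0 : 0 < r) (hr1 : r < 1) {n : ℕ} {a : Set unitInterval}
    (ha : a ∈ WFamily n) : IsSmall r n 0 {a} := by
  obtain ⟨c, hc⟩ : ∃ c, c ∉ a := by
    by_contra! hcon
    obtain ⟨k, J, -, hJ, haJ⟩ := ha
    have h1 : (1 : ℝ≥0∞) ≤ ∑ i, volume (J i) := by
      calc (1 : ℝ≥0∞) = volume a := by rw [eq_univ_of_forall hcon, measure_univ]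
        _ ≤ _ := by
            rw [haJ]
            exact measure_iUnion_fintype_le _ _
    have h2 : ((2 : ℝ≥0∞) ^ n)⁻¹ ≤ 1 := by
      rw [ENNReal.inv_le_one]
      exact one_le_pow₀ (by norm_num)
    exact absurd (hJ.trans_le h2) (not_lt.2 h1)
  refine ⟨ContinuousMap.const _ c, fun _ => univ, 1, one_pos, isNormalFamily_univ hr0 hr1, ?_⟩
  refine singleton_subset_iff.2 ⟨ha, fun ε hε => infinite_univ.mono fun i _ hXi => ?_⟩
  have huniv : firstProj (univ : Set (Fin (0 + 1) → unitInterval)) = univ :=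
    eq_univ_of_forall fun x => ⟨fun _ => x, trivial, rfl⟩
  have hempty : firstProj ((ContinuousMap.const (Fin (0 + 1) → unitInterval) c) ⁻¹' a) = ∅ := by
    refine eq_empty_of_forall_notMem ?_
    rintro x ⟨z, hz, -⟩
    exact hc hz
  have h := hXi ∅ (by simpa using hε)
  rw [hempty, empty_inter, empty_sdiff, hausdorffCapacity_empty hr0, huniv] at h
  have hone := volume_le_mul_hausdorffCapacity (r := r) (X := univ) (c := ENNReal.ofReal 1)
    (by simp) (by simp) (fun J _ => volume_inter_univ_le_rpow hr1 J) le_rfl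
  simp only [measure_univ, ENNReal.ofReal_one, one_mul] at hone
  simp only [ENNReal.ofReal_one, zero_add] at h
  exact absurd h (not_lt.2 hone)

theorem isSmall_sUnion (hr0 : 0 < r) (hr1 : r < 1) {n : ℕ} {𝒢 : Set (Set (Set unitInterval))}
    (hfin : 𝒢.Finite) (h : ∀ G ∈ 𝒢, ∃ d, IsSmall r n d G) : ∃ d, IsSmall r n d (⋃₀ 𝒢) := by
  induction 𝒢, hfin using Set.Finite.induction_on with
  | empty =>
    exact ⟨0, ContinuousMap.const _ 0, fun _ => univ, 1, one_pos, isNormalFamily_univ hr0 hr1,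
      by simp⟩
  | @insert G 𝒢 _ _ ih =>
    obtain ⟨d₁, h₁⟩ := h G (mem_insert _ _)
    obtain ⟨d₂, h₂⟩ := ih fun G' hG' => h G' (mem_insert_of_mem _ hG')
    rw [sUnion_insert]
    exact ⟨_, (h₁.mono_dim hr0 hr1 (le_max_left d₁ d₂)).union_of_eq_dim hr0 hr1
      (h₂.mono_dim hr0 hr1 (le_max_right d₁ d₂))⟩

theorem IsGenerator.isSmall {n : ℕ} {G : Set (Set unitInterval)} (h : IsGenerator r n G) :
    ∃ d, IsSmall r n d G := by
  obtain ⟨d, f, C, δ, hδ, hC, rfl⟩ := h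
  exact ⟨d, f, C, δ, hδ, hC, le_rfl⟩

theorem mem_capacityIdeal_iff {n : ℕ} {Y : Set (Set unitInterval)} :
    Y ∈ capacityIdeal r n ↔ ∃ d, IsSmall r n d Y := by
  constructor
  · rintro ⟨-, G, hG, hYG⟩
    obtain ⟨d, f, C, δ, hδ, hC, h⟩ := hG.isSmall
    exact ⟨d, f, C, δ, hδ, hC, hYG.trans h⟩
  · rintro ⟨d, f, C, δ, hδ, hC, h⟩
    exact ⟨h.trans fun a ha => ha.1, _, ⟨d, f, C, δ, hδ, hC, rfl⟩, h⟩

end Ideal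

theorem mainTheorem5 (r : ℝ) (hr0 : 0 < r) (hr1 : r < 1) (n : ℕ) :
    (∀ 𝒢 : Set (Set (Set unitInterval)), 𝒢.Finite → (∀ G ∈ 𝒢, IsGenerator r n G) →
      ¬ WFamily n ⊆ ⋃₀ 𝒢) ∧
    IsProperIdealOn (WFamily n) (capacityIdeal r n) := by
  have hproper : ∀ Y, (∃ d, IsSmall r n d Y) → ¬ WFamily n ⊆ Y := by
    rintro Y ⟨d, f, C, δ, hδ, hC, h⟩ hW
    exact not_WFamily_subset_generatorSet hr0 hr1 n f hC hδ (hW.trans h)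
  refine ⟨fun 𝒢 hfin h => hproper _ (isSmall_sUnion hr0 hr1 hfin fun G hG => (h G hG).isSmall),
    fun Y hY => hY.1, ?_, ?_, ?_, ?_⟩
  · intro Y hY hfin
    rw [mem_capacityIdeal_iff]
    have h := isSmall_sUnion hr0 hr1 (hfin.image singleton) (by
      rintro _ ⟨a, ha, rfl⟩
      exact ⟨0, isSmall_singleton hr0 hr1 (hY ha)⟩)
    rwa [Set.sUnion_image, Set.biUnion_of_singleton] at h
  · rintro Y ⟨hYW, G, hG, hYG⟩ Z hZ
    exact ⟨hZ.trans hYW, G, hG, hZ.trans hYG⟩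
  · intro Y hY Z hZ
    rw [mem_capacityIdeal_iff] at hY hZ ⊢
    have h := isSmall_sUnion hr0 hr1 (Set.toFinite {Y, Z}) (by
      rintro G (rfl | rfl)
      exacts [hY, hZ])
    rwa [Set.sUnion_pair] at h
  · exact fun h => hproper _ (mem_capacityIdeal_iff.1 h) le_rfl
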